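/- All graphs and logical structures are finite; graphs are undirected, without loops or parallel edges. A tree decomposition $t$ of a graph $G$ consists of a rooted forest and, for each node $x$ of the forest, a set of vertices of $G$ called the bag of $x$, such that every edge of $G$ is contained in some bag, and for every vertex of $G$ the set of nodes whose bags contain it is nonempty and connected in the forest. Its width is the maximum size of a bag minus one. For a node $x$ of $t$: the adhesion of $x$ is the intersection of the bag of $x$ with the bag of its parent (empty if $x$ is a root); the margin of $x$ is the bag of $x$ minus its adhesion; the cone of $x$ is the union of the bags of $x$ and of all its descendants; the component of $x$ is its cone minus its adhesion; the marginal graph of $x$ has the margin of $x$ as its vertex set, with two distinct vertices adjacent if they are adjacent in $G$ or belong together to the adhesion of some child of $x$. The decomposition $t$ is sane if, for every node $x$, the margin of $x$ is nonempty, the cone and the component of $x$ induce connected subgraphs of $G$, and every vertex of the adhesion of $x$ has a neighbor in the component of $x$. A nested tree decomposition of $G$ consists of a sane tree decomposition $t$ of $G$ (the main decomposition) and, for each node $x$ of $t$, a sane tree decomposition $t_x$ of the marginal graph of $x$ (a marginal decomposition). Its width is the maximum width of a marginal decomposition $t_x$ plus the maximum size of an adhesion of $t$. (Maxima over the empty set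 are $0$, and so is the width of a tree decomposition without nonempty bags.) A tree decomposition is encoded as a logical structure whose universe consists of the vertices and edges of $G$ and the nodes of $t$, with binary relations $\mathsf{incident}$ (a vertex is an endpoint of an edge), $\mathsf{bag}$ (a vertex is in the bag of a node) and $\mathsf{parent}$ (a node is the parent of a node). A nested tree decomposition is encoded as the disjoint union of the encodings of $t$ and of all the $t_x$ (each with its own underlying graph), with two further binary relations: $\mathsf{same}(v,v')$ holds if $v$ is a vertex of $G$ and $v'$ is its copy in the marginal graph of the node whose margin contains $v$; and $\mathsf{marginal}(y,x)$ holds if $y$ is a node of $t_x$. An MSO transduction is a finite composition of operations of three kinds: interpretations (given by an MSO sentence that the input has to satisfy, an MSO formula that selects the output universe from the input universe, and an MSO formula for each output relation); copyings (forming $k$ disjoint copies, together with a binary relation that relates copies of the same element and unary relations that mark the copies); and colorings (nondeterministically adding $k$ unary relations). It is deterministic if it uses no coloring; it then has at most one output on each input. Its domain is the class of structures on which it has an output. Structures are considered up to isomorphism. **Lemma.** There exists a deterministic MSO transduction whose domain is exactly the class of (structures encoding) nested tree decompositions, and which maps every nested tree decomposition of a graph $G$ to a tree decomposition of the same graph $G$.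 Moreover, for every $k\in\mathbb{N}$, if the input has width at most $k$, then so does the output. (The transduction does not depend on $k$.) -/

import Mathlib

namespace MSO

/-! ### Finite relational structures -/

/-- A finite relational vocabulary: finitely many relation names, each with an arity. -/
structure Vocabulary : Type 1 where
  Rel : Type
  arity : Rel → ℕ
  finite : Finite Rel

/-- A finite logical structure over a vocabulary (the universe may be empty). -/
structure Struct (S : Vocabulary) : Type 1 where
  carrier : Type
  finite : Finite carrier
  rel : ∀ R : S.Rel, (Fin (S.arity R) → carrier) → Prop

/-- Isomorphism of logical structures. -/
def Struct.Isomorphic {S : Vocabulary} (A B : Struct S) : Prop :=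
  ∃ e : A.carrier ≃ B.carrier, ∀ (R : S.Rel) (a : Fin (S.arity R) → A.carrier),
    A.rel R a ↔ B.rel R (fun i => e (a i))

/-! ### Monadic second-order logic -/

/-- `Formula S n m`: formulas of monadic second-order logic over the vocabulary `S`, with `n` free
element variables and `m` free set variables. A quantifier binds variable number `0` and shifts the
other variables of the same kind by one. -/
inductive Formula (S : Vocabulary) : ℕ → ℕ → Type
  | rel {n m : ℕ} (R : S.Rel) (x : Fin (S.arity R) → Fin n) : Formula S n m
  | eq {n m : ℕ} (x y : Fin n) : Formula S n m
  | mem {n m : ℕ} (x : Fin n) (X : Fin m) : Formula S n m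
  | neg {n m : ℕ} (p : Formula S n m) : Formula S n m
  | and {n m : ℕ} (p q : Formula S n m) : Formula S n m
  | existsElem {n m : ℕ} (p : Formula S (n + 1) m) : Formula S n m
  | existsSet {n m : ℕ} (p : Formula S n (m + 1)) : Formula S n m

/-- Satisfaction of a formula in a structure, under an assignment of its free variables. -/
def Formula.Sat {S : Vocabulary} (A : Struct S) :
    {n m : ℕ} → Formula S n m → (Fin n → A.carrier) → (Fin m → Set A.carrier) → Prop
  | _, _, .rel R x, v, _ => A.rel R (fun i => v (x i))
  | _, _, .eq x y, v, _ => v x = v y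
  | _, _, .mem x X, v, V => v x ∈ V X
  | _, _, .neg p, v, V => ¬ p.Sat A v V
  | _, _, .and p q, v, V => p.Sat A v V ∧ q.Sat A v V
  | _, _, .existsElem p, v, V => ∃ a : A.carrier, p.Sat A (Matrix.vecCons a v) V
  | _, _, .existsSet p, v, V => ∃ X : Set A.carrier, p.Sat A v (Matrix.vecCons X V)

/-! ### MSO transductions -/

/-- An MSO interpretation: a sentence checking whether the input is in the domain, a formula selecting
the output universe, and for every output relation a formula defining it. -/
structure Interpretation (S T : Vocabulary) where
  dom : Formula S 0 0
  univ : Formula S 1 0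
  rel : ∀ R : T.Rel, Formula S (T.arity R) 0

/-- The structure defined by an interpretation (to be used when the sentence `dom` holds). -/
def Interpretation.apply {S T : Vocabulary} (I : Interpretation S T) (A : Struct S) : Struct T where
  carrier := {a : A.carrier // I.univ.Sat A ![a] ![]}
  finite := by
    have := A.finite
    infer_instance
  rel R a := (I.rel R).Sat A (fun i => (a i).1) ![]

/-- The vocabulary of `k`-fold copies: `S`, a binary relation `copy` (here `Sum.inr (Sum.inl ())`)
and unary relations `layer i` (here `Sum.inr (Sum.inr i)`). -/
def Vocabulary.copy (S : Vocabulary) (k : ℕ) : Vocabulary where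
  Rel := S.Rel ⊕ (Unit ⊕ Fin k)
  arity := Sum.elim S.arity (Sum.elim (fun _ => 2) (fun _ => 1))
  finite := by
    have := S.finite
    infer_instance

/-- `k` disjoint copies of a structure; `copy a b` says that `a` and `b` are copies of the same
element, `layer i a` says that `a` lies in the `i`-th copy. -/
def Struct.copy {S : Vocabulary} (A : Struct S) (k : ℕ) : Struct (S.copy k) where
  carrier := Fin k × A.carrier
  finite := by
    have := A.finite
    infer_instance
  rel
    | .inl R => fun (a : Fin (S.arity R) → Fin k × A.carrier) =>
        (∃ i : Fin k, ∀ j, (a j).1 = i) ∧ A.rel R (fun j => (a j).2)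
    | .inr (.inl _) => fun (a : Fin 2 → Fin k × A.carrier) => (a 0).2 = (a 1).2
    | .inr (.inr i) => fun (a : Fin 1 → Fin k × A.carrier) => (a 0).1 = i

/-- The vocabulary extended by `k` unary relations (the colors). -/
def Vocabulary.color (S : Vocabulary) (k : ℕ) : Vocabulary where
  Rel := S.Rel ⊕ Fin k
  arity := Sum.elim S.arity (fun _ => 1)
  finite := by
    have := S.finite
    infer_instance

/-- The structure extended by `k` given subsets of the universe. -/
def Struct.color {S : Vocabulary} (A : Struct S) {k : ℕ} (X : Fin k → Set A.carrier) :
    Struct (S.color k) where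
  carrier := A.carrier
  finite := A.finite
  rel
    | .inl R => fun (a : Fin (S.arity R) → A.carrier) => A.rel R a
    | .inr i => fun (a : Fin 1 → A.carrier) => a 0 ∈ X i

/-- MSO transductions: finite compositions of interpretations, copyings and (nondeterministic)
colorings. -/
inductive Transduction : Vocabulary → Vocabulary → Type 1
  | interpretation {S T : Vocabulary} (I : Interpretation S T) : Transduction S T
  | copying {S : Vocabulary} (k : ℕ) : Transduction S (S.copy k)
  | coloring {S : Vocabulary} (k : ℕ) : Transduction S (S.color k)
  | comp {S T U : Vocabulary} (F : Transduction S T) (H : Transduction T U) : Transduction S U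

/-- The set of outputs (given up to isomorphism) of a transduction on an input structure. -/
def Transduction.outputs : {S T : Vocabulary} → Transduction S T → Struct S → Set (Struct T)
  | _, _, .interpretation I, A => {B | I.dom.Sat A ![] ![] ∧ B = I.apply A}
  | _, _, .copying k, A => {A.copy k}
  | _, _, .coloring k, A => {B | ∃ X : Fin k → Set A.carrier, B = A.color X}
  | _, _, .comp F H, A => {C | ∃ B ∈ F.outputs A, C ∈ H.outputs B}

/-- A transduction is deterministic if it does not use coloring. -/
def Transduction.Deterministic : {S T : Vocabulary} → Transduction S T → Prop
  | _, _, .interpretation _ => True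
  | _, _, .copying _ => True
  | _, _, .coloring _ => False
  | _, _, .comp F H => F.Deterministic ∧ H.Deterministic

/-- The vocabulary whose relation names are the elements of `R`, all of them binary. -/
def Vocabulary.binary (R : Type) [h : Finite R] : Vocabulary where
  Rel := R
  arity _ := 2
  finite := h

/-- The structure over a binary vocabulary given by a family of binary relations. -/
def Struct.ofBinary {R : Type} [Finite R] (U : Type) [h : Finite U] (P : R → U → U → Prop) :
    Struct (Vocabulary.binary R) where
  carrier := U
  finite := h
  rel r := fun (a : Fin 2 → U) => P r (a 0) (a 1)

end MSO

/-! ### Tree decompositions -/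

/-- A (finite) tree decomposition of a graph `G`. Its shape is a rooted forest, given by the partial
parent function; the roots are the nodes without a parent. -/
structure TreeDecomposition {V : Type} (G : SimpleGraph V) : Type 1 where
  Node : Type
  finite : Finite Node
  parent : Node → Option Node
  /-- No infinite chain of ancestors, so that `parent` is a rooted forest. -/
  wf : WellFounded (fun x y : Node => parent y = some x)
  bag : Node → Set V
  /-- Every edge is contained in some bag. -/
  edge_mem : ∀ u v : V, G.Adj u v → ∃ x, u ∈ bag x ∧ v ∈ bag x
  /-- For every vertex, the nodes whose bags contain it form a nonempty connected part of the
  forest. -/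
  vertex_connected : ∀ v : V,
    ((SimpleGraph.fromRel (fun x y : Node => parent x = some y)).induce {x | v ∈ bag x}).Connected

namespace TreeDecomposition

variable {V : Type} {G : SimpleGraph V}

/-- The bag of the parent of `x`, and the empty set if `x` is a root. -/
def parentBag (t : TreeDecomposition G) (x : t.Node) : Set V :=
  {v | ∃ y, t.parent x = some y ∧ v ∈ t.bag y}

/-- The adhesion of `x`: the vertices shared with the bag of its parent (empty for a root). -/
def adhesion (t : TreeDecomposition G) (x : t.Node) : Set V := t.bag x ∩ t.parentBag x

/-- The margin of `x`: the vertices of its bag that are not in the bag of its parent. -/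
def margin (t : TreeDecomposition G) (x : t.Node) : Set V := t.bag x \ t.parentBag x

/-- The cone of `x`: the union of the bags of `x` and of all its descendants. -/
def cone (t : TreeDecomposition G) (x : t.Node) : Set V :=
  {v | ∃ y, Relation.ReflTransGen (fun a b => t.parent b = some a) x y ∧ v ∈ t.bag y}

/-- The component of `x`: its cone without its adhesion. -/
def component (t : TreeDecomposition G) (x : t.Node) : Set V := t.cone x \ t.adhesion x

/-- The marginal graph of `x`: its vertices are the margin of `x`, and two of them are adjacent if
they are adjacent in `G` or lie together in the adhesion of some child of `x`. -/
def marginalGraph (t : TreeDecomposition G) (x : t.Node) : SimpleGraph (t.margin x) where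
  Adj u v := u ≠ v ∧
    (G.Adj u v ∨ ∃ y, t.parent y = some x ∧ (u : V) ∈ t.adhesion y ∧ (v : V) ∈ t.adhesion y)
  symm := ⟨fun _ _ h => ⟨h.1.symm, h.2.imp (fun e => e.symm) (fun ⟨y, a, b, c⟩ => ⟨y, a, c, b⟩)⟩⟩
  loopless := ⟨fun _ h => h.1 rfl⟩

/-- Sane tree decompositions. -/
structure Sane (t : TreeDecomposition G) : Prop where
  /-- No bag is contained in the bag of the parent; the bags of roots are nonempty. -/
  margin_nonempty : ∀ x, (t.margin x).Nonempty
  cone_connected : ∀ x, (G.induce (t.cone x)).Connected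
  component_connected : ∀ x, (G.induce (t.component x)).Connected
  /-- Every vertex of the adhesion of a node has a neighbor in the component of the node. -/
  adhesion_neighbor : ∀ x, ∀ v ∈ t.adhesion x, ∃ u ∈ t.component x, G.Adj v u

/-- The width: the maximum size of a bag, minus one (and `0` if there are no nonempty bags). -/
noncomputable def width (t : TreeDecomposition G) : ℕ := ⨆ x, ((t.bag x).ncard - 1)

/-- The universe of the structure encoding a tree decomposition: the vertices and edges of the
underlying graph, and the nodes. -/
inductive Elem (t : TreeDecomposition G) : Type
  | vertex (v : V)
  | edge (e : G.edgeSet)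
  | node (x : t.Node)

theorem finite_elem [Finite V] (t : TreeDecomposition G) : Finite t.Elem := by
  have := t.finite
  refine Finite.of_surjective
    (fun a : V ⊕ G.edgeSet ⊕ t.Node => match a with
      | .inl v => Elem.vertex v
      | .inr (.inl e) => Elem.edge e
      | .inr (.inr x) => Elem.node x) ?_
  rintro (v | e | x)
  exacts [⟨.inl v, rfl⟩, ⟨.inr (.inl e), rfl⟩, ⟨.inr (.inr x), rfl⟩]

/-- The relation names for tree decompositions. -/
inductive RelName : Type
  | incident
  | bag
  | parent

instance : Finite RelName :=
  Finite.of_injective (fun r : RelName => match r with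
    | .incident => (0 : Fin 3)
    | .bag => 1
    | .parent => 2) (by rintro (_ | _) (_ | _) h <;> first | rfl | simp at h)

/-- The relations of the structure encoding a tree decomposition: `incident v e` for a vertex `v` of
an edge `e`, `bag v x` for a vertex `v` in the bag of a node `x`, `parent x y` for the parent `x` of
a node `y`. -/
inductive Holds (t : TreeDecomposition G) : RelName → t.Elem → t.Elem → Prop
  | incident (v : V) (e : G.edgeSet) (h : v ∈ (e : Sym2 V)) : Holds t .incident (.vertex v) (.edge e)
  | bag (v : V) (x : t.Node) (h : v ∈ t.bag x) : Holds t .bag (.vertex v) (.node x)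
  | parent (x y : t.Node) (h : t.parent y = some x) : Holds t .parent (.node x) (.node y)

/-- The logical structure encoding a tree decomposition together with its underlying graph. -/
def encode [Finite V] (t : TreeDecomposition G) : MSO.Struct (MSO.Vocabulary.binary RelName) :=
  have := t.finite_elem
  MSO.Struct.ofBinary t.Elem t.Holds

end TreeDecomposition

/-! ### Nested tree decompositions -/

/-- A nested tree decomposition: a sane tree decomposition `main` of `G` and, for each of its nodes
`x`, a sane tree decomposition of the marginal graph of `x`. -/
structure NestedTreeDecomposition {V : Type} (G : SimpleGraph V) : Type 1 where
  main : TreeDecomposition G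
  main_sane : main.Sane
  marginal : ∀ x : main.Node, TreeDecomposition (main.marginalGraph x)
  marginal_sane : ∀ x, (marginal x).Sane

namespace NestedTreeDecomposition

variable {V : Type} {G : SimpleGraph V}

/-- The width: the maximum width of a marginal decomposition plus the maximum size of an adhesion of
the main decomposition. -/
noncomputable def width (N : NestedTreeDecomposition G) : ℕ :=
  (⨆ x, (N.marginal x).width) + ⨆ x, (N.main.adhesion x).ncard

/-- The universe of the encoding: the disjoint union of the universes of the encodings of the main
decomposition and of all marginal decompositions. -/
inductive Elem (N : NestedTreeDecomposition G) : Type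
  | main (a : N.main.Elem)
  | marginal (x : N.main.Node) (a : (N.marginal x).Elem)

theorem finite_elem [Finite V] (N : NestedTreeDecomposition G) : Finite N.Elem := by
  have := N.main.finite
  have := N.main.finite_elem
  have := fun x => (N.marginal x).finite_elem
  refine Finite.of_surjective
    (fun a : N.main.Elem ⊕ (Σ x, (N.marginal x).Elem) => match a with
      | .inl a => Elem.main a
      | .inr a => Elem.marginal a.1 a.2) ?_
  rintro (a | ⟨x, a⟩)
  exacts [⟨.inl a, rfl⟩, ⟨.inr ⟨x, a⟩, rfl⟩]

/-- The relation names for nested tree decompositions: those for tree decompositions and two more. -/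
inductive RelName : Type
  | incident
  | bag
  | parent
  | same
  | marginal

instance : Finite RelName :=
  Finite.of_injective (fun r : RelName => match r with
    | .incident => (0 : Fin 5)
    | .bag => 1
    | .parent => 2
    | .same => 3
    | .marginal => 4) (by rintro (_ | _) (_ | _) h <;> first | rfl | simp at h)

/-- The relation names for tree decompositions, as relation names for nested tree decompositions. -/
def RelName.ofTree : TreeDecomposition.RelName → RelName
  | .incident => .incident
  | .bag => .bag
  | .parent => .parent

/-- The relations of the encoding: those of the disjoint union of the encodings of all the
decompositions; `same v v'` if `v'` is the copy, in the graph underlying a marginal decomposition, of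
the vertex `v` of the graph underlying the main decomposition; and `marginal y x` if `y` is a node of
the marginal decomposition of the node `x`. -/
inductive Holds (N : NestedTreeDecomposition G) : RelName → N.Elem → N.Elem → Prop
  | ofMain (R : TreeDecomposition.RelName) (a b : N.main.Elem) (h : N.main.Holds R a b) :
      Holds N (.ofTree R) (.main a) (.main b)
  | ofMarginal (R : TreeDecomposition.RelName) (x : N.main.Node) (a b : (N.marginal x).Elem)
      (h : (N.marginal x).Holds R a b) :
      Holds N (.ofTree R) (.marginal x a) (.marginal x b)
  | same (x : N.main.Node) (v : N.main.margin x) :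
      Holds N .same (.main (.vertex (v : V))) (.marginal x (.vertex v))
  | marginal (x : N.main.Node) (y : (N.marginal x).Node) :
      Holds N .marginal (.marginal x (.node y)) (.main (.node x))

/-- The logical structure encoding a nested tree decomposition. -/
def encode [Finite V] (N : NestedTreeDecomposition G) :
    MSO.Struct (MSO.Vocabulary.binary RelName) :=
  have := N.finite_elem
  MSO.Struct.ofBinary N.Elem N.Holds

end NestedTreeDecomposition

/-!
# Flattening nested tree decompositions by a deterministic MSO transduction

Each bag of a marginal decomposition `t_x` is enlarged by the adhesion of `x` in the main
decomposition, and the nodes of all marginal decompositions, with these bags, are arranged in a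
single forest. Inside `t_x` the parents are kept. A root of `t_x` is attached below a node whose
bag contains the whole adhesion of `x` and is the topmost node of one of the vertices of this
adhesion; the two conditions determine the node (`flatTop_eq_flatTop`). It exists if the adhesion
is nonempty (`exists_flatTop_of_adhesion`): the deepest main node `b` in which a vertex of the
adhesion appears for the first time on the way down has the whole adhesion in its bag, the part of
the adhesion in the margin of `b` is a clique of the marginal graph of `b`, and cliques lie in
bags (`TreeDecomposition.exists_top_of_clique`). If the adhesion is empty, the root of `t_x` stays
a root. For a rooted forest, connectivity of a nonempty set of nodes means having a single topmost
node (`connected_induce_fromRel_iff`), so that it suffices to find the topmost nodes of each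
vertex in the flattened forest (`isTop_flatBag_iff`).

Vertices and edges of the graph and nodes of the output are all elements of the input structure,
so a single interpretation computes the output. Its formulas are obtained from closure properties
of `MSO.Definable` properties; set quantifiers are needed only for reflexive transitive closures
and well-foundedness.

The domain is cut out by the axioms `IsEncoding`. They speak about the relations of a structure
directly, by means of `RelDecomp`, which expresses tree decompositions and their sanity for
vertices and nodes from one universe; `RelDecomp.Realizes.isSane_iff` and
`RelDecomp.IsSane.exists_realizes` translate between the two views. Encodings satisfy the axioms
(`isEncoding_holds`), and every structure satisfying them is isomorphic to an encoding
(`IsEncoding.exists_equiv`). Since satisfaction of formulas is invariant under isomorphism, the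
interpretation has to be evaluated only on the encodings themselves.
-/

/-! ### Definable properties of structures -/

namespace MSO

variable {S : Vocabulary} {n m : ℕ}

/-- A property of structures with `n` elements and `m` sets is definable if some formula of monadic
second-order logic expresses it. The closure lemmas below replace variable number `0` of a
quantified formula by `w 0` and the older variables by `fun i => w i.succ`, so that they apply to
properties written with ordinary quantifiers. -/
def Definable (P : ∀ A : Struct S, (Fin n → A.carrier) → (Fin m → Set A.carrier) → Prop) : Prop :=
  ∃ φ : Formula S n m, ∀ A v V, φ.Sat A v V ↔ P A v V

namespace Definable

variable {P Q : ∀ A : Struct S, (Fin n → A.carrier) → (Fin m → Set A.carrier) → Prop}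

theorem congr (h : Definable P) (hPQ : ∀ A v V, P A v V ↔ Q A v V) : Definable Q := by
  obtain ⟨φ, hφ⟩ := h
  exact ⟨φ, fun A v V => (hφ A v V).trans (hPQ A v V)⟩

theorem not (h : Definable P) : Definable (fun A v V => ¬ P A v V) := by
  obtain ⟨φ, hφ⟩ := h
  exact ⟨.neg φ, fun A v V => not_congr (hφ A v V)⟩

theorem and (h : Definable P) (k : Definable Q) : Definable (fun A v V => P A v V ∧ Q A v V) := by
  obtain ⟨φ, hφ⟩ := h
  obtain ⟨ψ, hψ⟩ := k
  exact ⟨.and φ ψ, fun A v V => and_congr (hφ A v V) (hψ A v V)⟩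

theorem or (h : Definable P) (k : Definable Q) : Definable (fun A v V => P A v V ∨ Q A v V) :=
  (h.not.and k.not).not.congr fun _ _ _ => by tauto

theorem imp (h : Definable P) (k : Definable Q) : Definable (fun A v V => P A v V → Q A v V) :=
  (h.and k.not).not.congr fun _ _ _ => by tauto

theorem ex {P : ∀ A : Struct S, A.carrier → (Fin n → A.carrier) → (Fin m → Set A.carrier) → Prop}
    (h : Definable (n := n + 1) fun A w V => P A (w 0) (fun i => w i.succ) V) :
    Definable (fun A v V => ∃ a, P A a v V) := by
  obtain ⟨φ, hφ⟩ := h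
  exact ⟨.existsElem φ, fun A v V => exists_congr fun a => hφ A (Matrix.vecCons a v) V⟩

theorem all {P : ∀ A : Struct S, A.carrier → (Fin n → A.carrier) → (Fin m → Set A.carrier) → Prop}
    (h : Definable (n := n + 1) fun A w V => P A (w 0) (fun i => w i.succ) V) :
    Definable (fun A v V => ∀ a, P A a v V) :=
  (h.not.ex (P := fun A a v V => ¬ P A a v V)).not.congr fun _ _ _ => by simp

theorem allSet
    {P : ∀ A : Struct S, Set A.carrier → (Fin n → A.carrier) → (Fin m → Set A.carrier) → Prop}
    (h : Definable (m := m + 1) fun A v W => P A (W 0) v (fun i => W i.succ)) :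
    Definable (fun A v V => ∀ X, P A X v V) := by
  obtain ⟨φ, hφ⟩ := h.not
  refine ⟨.neg (.existsSet φ), fun A v V => ?_⟩
  refine Iff.trans (not_congr (exists_congr fun X => hφ A v (Matrix.vecCons X V))) ?_
  exact not_exists_not

theorem eq (i j : Fin n) : Definable (S := S) (m := m) fun _ v _ => v i = v j :=
  ⟨.eq i j, fun _ _ _ => Iff.rfl⟩

theorem mem (i : Fin n) (X : Fin m) : Definable (S := S) fun _ v V => v i ∈ V X :=
  ⟨.mem i X, fun _ _ _ => Iff.rfl⟩

/-- Reflexive transitive closures are definable: `y` can be reached from `x` if it lies in every set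
that contains `x` and is closed under the relation. -/
theorem reflTransGen
    {r : ∀ A : Struct S,
      A.carrier → A.carrier → (Fin n → A.carrier) → (Fin m → Set A.carrier) → Prop}
    (h : Definable (n := n + 1 + 1) (m := m + 1) fun A w W =>
      r A (w (Fin.succ 0)) (w 0) (fun i => w i.succ.succ) (fun i => W i.succ)) (x y : Fin n) :
    Definable fun A v V => Relation.ReflTransGen (fun a b => r A a b v V) (v x) (v y) := by
  have key : Definable (S := S) (n := n) (m := m) fun A v V => ∀ X : Set A.carrier,
      v x ∈ X → (∀ a b, a ∈ X → r A a b v V → b ∈ X) → v y ∈ X :=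
    allSet (imp (mem _ _) (imp (all (all (imp (mem _ _) (imp h (mem _ _))))) (mem _ _)))
  refine key.congr fun A v V => ⟨fun H => ?_, fun H X hx hX => ?_⟩
  · exact H {c | Relation.ReflTransGen (fun a b => r A a b v V) (v x) c} .refl
      fun a b ha hab => ha.tail hab
  · have closed : ∀ c, Relation.ReflTransGen (fun a b => r A a b v V) (v x) c → c ∈ X := by
      intro c hc
      induction hc with
      | refl => exact hx
      | tail _ hab ih => exact hX _ _ ih hab
    exact closed _ H

/-- Well-foundedness is definable: every nonempty set has a minimal element. -/
theorem wellFounded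
    {r : ∀ A : Struct S,
      A.carrier → A.carrier → (Fin n → A.carrier) → (Fin m → Set A.carrier) → Prop}
    (h : Definable (n := n + 1 + 1) (m := m + 1) fun A w W =>
      r A (w 0) (w (Fin.succ 0)) (fun i => w i.succ.succ) (fun i => W i.succ)) :
    Definable fun A v V => WellFounded (fun a b => r A a b v V) := by
  have key : Definable (S := S) (n := n) (m := m) fun A v V => ∀ X : Set A.carrier,
      (∃ a, a ∈ X) → ∃ a, a ∈ X ∧ ∀ b, b ∈ X → ¬ r A b a v V :=
    allSet (imp (ex (mem _ _)) (ex (and (mem _ _) (all (imp (mem _ _) (not h))))))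
  exact key.congr fun A v V => WellFounded.wellFounded_iff_has_min.symm

end Definable

/-- The relations of a structure over a binary vocabulary, as a family of binary relations. -/
def Struct.holds {R : Type} [Finite R] (A : Struct (Vocabulary.binary R)) (r : R)
    (a b : A.carrier) : Prop :=
  A.rel r (fun i : Fin 2 => (![a, b] : Fin 2 → A.carrier) i)

theorem Definable.holds {R : Type} [Finite R] (r : R) (i j : Fin n) :
    Definable (S := Vocabulary.binary R) (m := m) fun A v _ => A.holds r (v i) (v j) := by
  refine ⟨.rel (S := Vocabulary.binary R) r (fun k : Fin 2 => ![i, j] k), fun A v V => ?_⟩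
  have : (fun k : Fin 2 => v (![i, j] k)) = fun k : Fin 2 => ![v i, v j] k := by
    funext k
    fin_cases k <;> rfl
  exact iff_of_eq (congrArg (A.rel r) this)

theorem Struct.rel_iff_holds {R : Type} [Finite R] (A : Struct (Vocabulary.binary R)) (r : R)
    (a : Fin 2 → A.carrier) : A.rel r a ↔ A.holds r (a 0) (a 1) := by
  have : a = fun k : Fin 2 => ![a 0, a 1] k := by
    funext k
    fin_cases k <;> rfl
  exact iff_of_eq (congrArg (A.rel r) this)

/-! ### Invariance under isomorphism -/

theorem Struct.Isomorphic.trans {A B C : Struct S} (h : A.Isomorphic B) (k : B.Isomorphic C) :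
    A.Isomorphic C := by
  obtain ⟨e, he⟩ := h
  obtain ⟨f, hf⟩ := k
  exact ⟨e.trans f, fun R a => (he R a).trans (hf R _)⟩

theorem Struct.Isomorphic.symm {A B : Struct S} (h : A.Isomorphic B) : B.Isomorphic A := by
  obtain ⟨e, he⟩ := h
  refine ⟨e.symm, fun R a => ?_⟩
  rw [he]
  simp

theorem Formula.sat_iff_of_equiv {A B : Struct S} (e : A.carrier ≃ B.carrier)
    (he : ∀ (R : S.Rel) (a : Fin (S.arity R) → A.carrier), A.rel R a ↔ B.rel R (fun i => e (a i)))
    (φ : Formula S n m) (v : Fin n → A.carrier) (V : Fin m → Set A.carrier) :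
    φ.Sat A v V ↔ φ.Sat B (fun i => e (v i)) (fun i => e '' V i) := by
  have cons_elem : ∀ {n : ℕ} (a : A.carrier) (v : Fin n → A.carrier),
      (fun i => e (Matrix.vecCons a v i)) = Matrix.vecCons (e a) (fun i => e (v i)) := by
    intro n a v
    funext i
    refine Fin.cases ?_ (fun i => ?_) i <;> rfl
  have cons_set : ∀ {m : ℕ} (X : Set A.carrier) (V : Fin m → Set A.carrier),
      (fun i => e '' Matrix.vecCons X V i) = Matrix.vecCons (e '' X) (fun i => e '' V i) := by
    intro m X V
    funext i
    refine Fin.cases ?_ (fun i => ?_) i <;> rfl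
  induction φ with
  | rel R x => exact he R _
  | eq x y => exact e.injective.eq_iff.symm
  | mem x X => exact (e.injective.mem_set_image).symm
  | neg p ih => exact not_congr (ih v V)
  | and p q ihp ihq => exact and_congr (ihp v V) (ihq v V)
  | existsElem p ih =>
    simp only [Formula.Sat]
    constructor
    · rintro ⟨a, ha⟩
      exact ⟨e a, by simpa only [cons_elem] using (ih _ _).1 ha⟩
    · rintro ⟨b, hb⟩
      refine ⟨e.symm b, (ih _ _).2 ?_⟩
      simpa only [cons_elem, Equiv.apply_symm_apply] using hb
  | existsSet p ih =>
    simp only [Formula.Sat]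
    constructor
    · rintro ⟨X, hX⟩
      exact ⟨e '' X, by simpa only [cons_set] using (ih _ _).1 hX⟩
    · rintro ⟨Y, hY⟩
      refine ⟨e.symm '' Y, (ih _ _).2 ?_⟩
      simpa only [cons_set, Equiv.image_symm_image, Equiv.image_symm_eq_preimage,
        Equiv.image_preimage] using hY

theorem Formula.sat_iff_of_isomorphic {A B : Struct S} (h : A.Isomorphic B) (φ : Formula S 0 0) :
    φ.Sat A ![] ![] ↔ φ.Sat B ![] ![] := by
  obtain ⟨e, he⟩ := h
  rw [φ.sat_iff_of_equiv e he, Subsingleton.elim (fun i => e _) ![],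
    Subsingleton.elim (fun i => e '' _) ![]]

theorem Interpretation.apply_isomorphic {T : Vocabulary} (I : Interpretation S T) {A B : Struct S}
    (h : A.Isomorphic B) : (I.apply A).Isomorphic (I.apply B) := by
  obtain ⟨e, he⟩ := h
  refine ⟨e.subtypeEquiv fun a => ?_, fun R a => ?_⟩
  · rw [I.univ.sat_iff_of_equiv e he, Subsingleton.elim (fun i => e '' _) ![],
      funext (Fin.forall_fin_one.2 rfl : ∀ i, e (![a] i) = ![e a] i)]
  · exact ((I.rel R).sat_iff_of_equiv e he _ _).trans
      (iff_of_eq (congrArg (Formula.Sat B (I.rel R) _) (Subsingleton.elim _ _)))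

end MSO

/-! ### Rooted forests and tree decompositions -/

/-- In a rooted forest, a set of nodes is nonempty and connected if and only if it has exactly one
topmost node, that is, one whose parent lies outside the set. -/
theorem connected_induce_fromRel_iff {α : Type} {par : α → α → Prop}
    (hpar : ∀ a b c, par a c → par b c → a = b) (wf : WellFounded par) (S : Set α) :
    ((SimpleGraph.fromRel fun x y => par y x).induce S).Connected ↔
      ∃! x, x ∈ S ∧ ∀ y, par y x → y ∉ S := by
  constructor
  · intro hS
    obtain ⟨⟨x₀, hx₀⟩⟩ := hS.nonempty
    refine ⟨wf.min S ⟨x₀, hx₀⟩, ⟨wf.min_mem _ _, fun y hy hyS => wf.not_lt_min S hyS hy⟩, ?_⟩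
    rintro m' ⟨hm', hm'_top⟩
    generalize hm_eq : wf.min S ⟨x₀, hx₀⟩ = m
    have hm : m ∈ S := hm_eq ▸ wf.min_mem _ _
    have hm_top : ∀ y, par y m → y ∉ S := by
      intro y hy hyS
      exact wf.not_lt_min S hyS (hm_eq ▸ hy)
    -- Moving inside `S` never leaves the set of nodes that can be reached downwards from `m`.
    have step : ∀ z : S, ((SimpleGraph.fromRel fun x y => par y x).induce S).Reachable ⟨m, hm⟩ z →
        Relation.ReflTransGen (fun a b => a ∈ S ∧ par a b) m z := by
      intro z hz
      rw [SimpleGraph.reachable_iff_reflTransGen] at hz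
      induction hz with
      | refl => exact .refl
      | @tail b c _ hbc ih =>
        have hbc' : par (c : α) b ∨ par (b : α) c := hbc.2
        rcases hbc' with h | h
        · rcases Relation.ReflTransGen.cases_tail ih with h' | ⟨d, hd, hdS, hdb⟩
          · exact absurd c.2 (hm_top _ (by rw [← h']; exact h))
          · rw [hpar _ _ _ h hdb]
            exact hd
        · exact ih.tail ⟨b.2, h⟩
    rcases Relation.ReflTransGen.cases_tail (step ⟨m', hm'⟩ (hS.preconnected _ _)) with
      h | ⟨d, -, hdS, hd⟩
    · exact h
    · exact absurd hdS (hm'_top d hd)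
  · rintro ⟨m, ⟨hm, -⟩, huniq⟩
    have reach : ∀ x (hx : x ∈ S),
        ((SimpleGraph.fromRel fun x y => par y x).induce S).Reachable ⟨m, hm⟩ ⟨x, hx⟩ := by
      intro x
      induction x using wf.induction with
      | _ x ih =>
        intro hx
        by_cases h : ∃ y, par y x ∧ y ∈ S
        · obtain ⟨y, hyx, hy⟩ := h
          refine (ih y hyx hy).trans (SimpleGraph.Adj.reachable ?_)
          have hne : y ≠ x := by
            rintro rfl
            exact wf.irrefl.irrefl _ hyx
          exact ⟨hne, Or.inr hyx⟩
        · push Not at h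
          obtain rfl := huniq x ⟨hx, h⟩
          exact .rfl
    have : Nonempty S := ⟨⟨m, hm⟩⟩
    exact ⟨fun a b => (reach a a.2).symm.trans (reach b b.2)⟩

namespace TreeDecomposition

variable {V : Type} {G : SimpleGraph V}

open Classical in
theorem dite_choose_eq_some_iff {α : Type} {par : α → α → Prop}
    (hpar : ∀ a b c, par a c → par b c → a = b) (x y : α) :
    (if h : ∃ z, par z x then some h.choose else none) = some y ↔ par y x := by
  by_cases h : ∃ z, par z x
  · rw [dif_pos h, Option.some.injEq]
    exact ⟨fun e => e ▸ h.choose_spec, fun hy => hpar _ _ _ h.choose_spec hy⟩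
  · rw [dif_neg h]
    exact ⟨fun e => by simp at e, fun hy => absurd ⟨y, hy⟩ h⟩

open Classical in
/-- The tree decomposition whose forest is given by a parent relation instead of a parent function,
and whose bags satisfy the following form of the connectivity condition: every vertex has exactly
one topmost node among those whose bag contains it. -/
noncomputable def ofRel {α : Type} [Finite α] (par : α → α → Prop)
    (hpar : ∀ a b c, par a c → par b c → a = b) (wf : WellFounded par) (bag : α → Set V)
    (edge : ∀ u v, G.Adj u v → ∃ x, u ∈ bag x ∧ v ∈ bag x)
    (vertex : ∀ v, ∃! x, v ∈ bag x ∧ ∀ y, par y x → v ∉ bag y) : TreeDecomposition G where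
  Node := α
  finite := ‹_›
  parent x := if h : ∃ z, par z x then some h.choose else none
  wf := by simpa only [dite_choose_eq_some_iff hpar] using wf
  bag := bag
  edge_mem := edge
  vertex_connected v := by
    simp only [dite_choose_eq_some_iff hpar]
    exact (connected_induce_fromRel_iff hpar wf _).2 (vertex v)

theorem ofRel_parent {α : Type} [Finite α] (par : α → α → Prop)
    (hpar : ∀ a b c, par a c → par b c → a = b) (wf : WellFounded par) (bag : α → Set V)
    (edge : ∀ u v, G.Adj u v → ∃ x, u ∈ bag x ∧ v ∈ bag x)
    (vertex : ∀ v, ∃! x, v ∈ bag x ∧ ∀ y, par y x → v ∉ bag y) (x y : α) :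
    (ofRel par hpar wf bag edge vertex).parent x = some y ↔ par y x :=
  dite_choose_eq_some_iff hpar x y

variable (t : TreeDecomposition G)

/-- `t.Above a b` says that the node `a` is `b` or an ancestor of `b`. -/
def Above (a b : t.Node) : Prop := Relation.ReflTransGen (fun a b => t.parent b = some a) a b

variable {t}

theorem Above.antisymm {a b : t.Node} (h : t.Above a b) (k : t.Above b a) : a = b := by
  rcases Relation.reflTransGen_iff_eq_or_transGen.1 h with h' | h'
  · exact h'.symm
  · exact absurd (h'.trans_left k) (t.wf.transGen.irrefl.irrefl a)

theorem Above.total {a b c : t.Node} (h : t.Above a c) (k : t.Above b c) :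
    t.Above a b ∨ t.Above b a := by
  have hu : Relator.RightUnique (fun x y : t.Node => t.parent x = some y) := by
    intro x y z hy hz
    rw [hy] at hz
    exact Option.some.inj hz
  have h' := Relation.ReflTransGen.total_of_right_unique hu
    (Relation.reflTransGen_swap.2 h) (Relation.reflTransGen_swap.2 k)
  exact h'.symm.imp Relation.reflTransGen_swap.1 Relation.reflTransGen_swap.1

variable (t)

theorem existsUnique_mem_margin (v : V) : ∃! x, v ∈ t.margin x := by
  have h := (connected_induce_fromRel_iff (par := fun a b => t.parent b = some a)
    (fun a b c ha hb => Option.some.inj (ha.symm.trans hb)) t.wf _).1 (t.vertex_connected v)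
  refine (existsUnique_congr fun x => and_congr Iff.rfl ?_).1 h
  simp [parentBag]

/-- The topmost node whose bag contains `v`. -/
noncomputable def top (v : V) : t.Node := (t.existsUnique_mem_margin v).choose

theorem mem_margin_top (v : V) : v ∈ t.margin (t.top v) :=
  (t.existsUnique_mem_margin v).choose_spec.1

theorem mem_margin_iff {v : V} {x : t.Node} : v ∈ t.margin x ↔ t.top v = x :=
  ⟨fun h => ((t.existsUnique_mem_margin v).choose_spec.2 x h).symm,
    fun h => h ▸ t.mem_margin_top v⟩

variable {t}

theorem margin_subset_bag (x : t.Node) : t.margin x ⊆ t.bag x := Set.sdiff_subset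

theorem mem_margin_or_mem_adhesion {v : V} {x : t.Node} (h : v ∈ t.bag x) :
    v ∈ t.margin x ∨ v ∈ t.adhesion x := by
  by_cases k : v ∈ t.parentBag x
  · exact Or.inr ⟨h, k⟩
  · exact Or.inl ⟨h, k⟩

theorem top_above {v : V} {x : t.Node} (h : v ∈ t.bag x) : t.Above (t.top v) x := by
  induction x using t.wf.induction with
  | _ x ih =>
    rcases mem_margin_or_mem_adhesion h with h' | ⟨-, y, hy, hv⟩
    · rw [t.mem_margin_iff.1 h']
      exact .refl
    · exact (ih y hy hv).tail hy

/-- Bags on the path between the topmost node of a vertex and another node of the vertex contain the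
vertex. -/
theorem mem_bag_of_above {v : V} {b c : t.Node} (hb : t.Above (t.top v) b) (hbc : t.Above b c)
    (hc : v ∈ t.bag c) : v ∈ t.bag b := by
  induction hbc with
  | refl => exact hc
  | @tail d c hbd hdc ih =>
    refine ih ?_
    rcases mem_margin_or_mem_adhesion hc with h | ⟨-, y, hy, hv⟩
    · -- Otherwise `c` would be the topmost node of `v`, yet lie strictly below it.
      rw [t.mem_margin_iff] at h
      subst h
      exact absurd (Relation.TransGen.tail' (hb.trans hbd) hdc) (t.wf.transGen.irrefl.irrefl _)
    · rw [Option.some.inj (hdc.symm.trans hy)]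
      exact hv

theorem exists_top_of_subset_bag {S : Set V} (hS : S.Nonempty) {x : t.Node} (h : S ⊆ t.bag x) :
    ∃ w ∈ S, S ⊆ t.bag (t.top w) := by
  induction x using t.wf.induction with
  | _ x ih =>
    by_cases hx : ∃ w ∈ S, w ∈ t.margin x
    · obtain ⟨w, hw, hwx⟩ := hx
      exact ⟨w, hw, by rwa [t.mem_margin_iff.1 hwx]⟩
    · push Not at hx
      have hS' : ∀ v ∈ S, v ∈ t.parentBag x := fun v hv =>
        ((mem_margin_or_mem_adhesion (h hv)).resolve_left (hx v hv)).2
      obtain ⟨v, hv⟩ := hS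
      obtain ⟨y, hy, -⟩ := hS' v hv
      refine ih y hy fun u hu => ?_
      obtain ⟨y', hy', hu'⟩ := hS' u hu
      rwa [Option.some.inj (hy.symm.trans hy')]

/-- Every nonempty clique is contained in a bag, namely in the deepest of the topmost nodes of its
vertices. -/
theorem exists_top_of_clique {C : Set V} (hfin : C.Finite) (hne : C.Nonempty)
    (hC : ∀ u ∈ C, ∀ v ∈ C, u ≠ v → G.Adj u v) : ∃ w ∈ C, C ⊆ t.bag (t.top w) := by
  induction C, hfin using Set.Finite.induction_on with
  | empty => exact absurd hne Set.not_nonempty_empty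
  | @insert u C _ _ ih =>
    have mem_top : ∀ v, v ∈ t.bag (t.top v) := fun v => margin_subset_bag _ (t.mem_margin_top v)
    rcases C.eq_empty_or_nonempty with rfl | hne'
    · exact ⟨u, Set.mem_insert _ _, fun v hv => by
        rcases hv with rfl | hv
        · exact mem_top _
        · exact absurd hv (Set.notMem_empty _)⟩
    obtain ⟨w, hw, hCw⟩ := ih hne' fun a ha b hb hab =>
      hC a (Set.mem_insert_of_mem _ ha) b (Set.mem_insert_of_mem _ hb) hab
    have common : ∀ v ∈ C, ∃ z, u ∈ t.bag z ∧ v ∈ t.bag z := by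
      intro v hv
      by_cases huv : u = v
      · exact ⟨t.top u, mem_top u, huv ▸ mem_top u⟩
      · exact t.edge_mem _ _ (hC u (Set.mem_insert _ _) v (Set.mem_insert_of_mem _ hv) huv)
    obtain ⟨z, huz, hwz⟩ := common w hw
    rcases (top_above huz).total (top_above hwz) with h | h
    · refine ⟨w, Set.mem_insert_of_mem _ hw, Set.insert_subset ?_ hCw⟩
      exact mem_bag_of_above h (top_above hwz) huz
    · refine ⟨u, Set.mem_insert _ _, Set.insert_subset (mem_top u) fun v hv => ?_⟩
      obtain ⟨z', huz', hvz'⟩ := common v hv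
      exact mem_bag_of_above ((top_above (hCw hv)).trans h) (top_above huz') hvz'

end TreeDecomposition

/-! ### Flattening a nested tree decomposition -/

namespace NestedTreeDecomposition

variable {V : Type} {G : SimpleGraph V} (N : NestedTreeDecomposition G)

/-- The nodes of the flattened decomposition: all nodes of all marginal decompositions. -/
abbrev FlatNode : Type := Σ x : N.main.Node, (N.marginal x).Node

instance : Finite N.FlatNode :=
  have := N.main.finite
  have := fun x => (N.marginal x).finite
  inferInstance

/-- The bags of the flattened decomposition: the bag in the marginal decomposition of a node `x`,
together with the adhesion of `x`. -/
def flatBag (b : N.FlatNode) : Set V :=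
  Subtype.val '' (N.marginal b.1).bag b.2 ∪ N.main.adhesion b.1

/-- The topmost node of `v` in the flattened decomposition. -/
noncomputable def flatTop (v : V) : N.FlatNode :=
  ⟨N.main.top v, (N.marginal (N.main.top v)).top ⟨v, N.main.mem_margin_top v⟩⟩

/-- `N.FlatParent b a` says that `b` is the parent of `a` in the flattened decomposition. A root of
the marginal decomposition of `x` is put below the deepest of the topmost nodes of the vertices in
the adhesion of `x`, which is the one whose bag contains the whole adhesion; it stays a root if the
adhesion is empty. -/
inductive FlatParent : N.FlatNode → N.FlatNode → Prop
  | inner (x : N.main.Node) (y y' : (N.marginal x).Node) (h : (N.marginal x).parent y = some y') :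
      FlatParent ⟨x, y'⟩ ⟨x, y⟩
  | outer (x : N.main.Node) (y : (N.marginal x).Node) (w : V) (h : (N.marginal x).parent y = none)
      (hw : w ∈ N.main.adhesion x) (hx : N.main.adhesion x ⊆ N.flatBag (N.flatTop w)) :
      FlatParent (N.flatTop w) ⟨x, y⟩

variable {N}

theorem flatTop_eq {v : V} {x : N.main.Node} (h : v ∈ N.main.margin x) :
    N.flatTop v = ⟨x, (N.marginal x).top ⟨v, h⟩⟩ := by
  obtain rfl := N.main.mem_margin_iff.1 h
  rfl

theorem flatTop_eq_iff {v : V} {x : N.main.Node} {y : (N.marginal x).Node} :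
    N.flatTop v = ⟨x, y⟩ ↔
      ∃ h : v ∈ N.main.margin x, (⟨v, h⟩ : N.main.margin x) ∈ (N.marginal x).margin y := by
  constructor
  · intro h
    have hx : N.main.top v = x := congrArg Sigma.fst h
    subst hx
    refine ⟨N.main.mem_margin_top v, (TreeDecomposition.mem_margin_iff _).2 ?_⟩
    exact eq_of_heq (Sigma.mk.inj h).2
  · rintro ⟨h, hy⟩
    rw [flatTop_eq h, (TreeDecomposition.mem_margin_iff _).1 hy]

theorem flatBag_subset_bag (b : N.FlatNode) : N.flatBag b ⊆ N.main.bag b.1 := by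
  rintro v (⟨u, -, rfl⟩ | h)
  · exact TreeDecomposition.margin_subset_bag _ u.2
  · exact h.1

theorem mem_flatBag_iff {v : V} {x : N.main.Node} {y : (N.marginal x).Node} :
    v ∈ N.flatBag ⟨x, y⟩ ↔
      (∃ h : v ∈ N.main.margin x, (⟨v, h⟩ : N.main.margin x) ∈ (N.marginal x).bag y) ∨
        v ∈ N.main.adhesion x := by
  refine or_congr ⟨?_, ?_⟩ Iff.rfl
  · rintro ⟨u, hu, rfl⟩
    exact ⟨u.2, hu⟩
  · rintro ⟨h, hv⟩
    exact ⟨⟨v, h⟩, hv, rfl⟩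

theorem notMem_adhesion {v : V} {x : N.main.Node} (h : v ∈ N.main.margin x) :
    v ∉ N.main.adhesion x := fun h' => h.2 h'.2

theorem mem_flatBag_flatTop (v : V) : v ∈ N.flatBag (N.flatTop v) :=
  mem_flatBag_iff.2 <| Or.inl ⟨N.main.mem_margin_top v,
    TreeDecomposition.margin_subset_bag _ (TreeDecomposition.mem_margin_top _ _)⟩

/-- If the flat bags at the topmost nodes of `v` and of `w` contain both vertices, the two nodes
coincide. Hence a root of a marginal decomposition is given at most one parent. -/
theorem flatTop_eq_flatTop {v w : V} (h : v ∈ N.flatBag (N.flatTop w))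
    (k : w ∈ N.flatBag (N.flatTop v)) : N.flatTop v = N.flatTop w := by
  have hx : N.main.top v = N.main.top w :=
    (TreeDecomposition.top_above (flatBag_subset_bag _ h)).antisymm
      (TreeDecomposition.top_above (flatBag_subset_bag _ k))
  have hv : v ∈ N.main.margin (N.main.top w) := N.main.mem_margin_iff.2 hx
  have hw : w ∈ N.main.margin (N.main.top w) := N.main.mem_margin_top w
  rw [flatTop_eq hv] at k ⊢
  rw [flatTop_eq hw] at h ⊢
  obtain ⟨_, h'⟩ := (mem_flatBag_iff.1 h).resolve_right (notMem_adhesion hv)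
  obtain ⟨_, k'⟩ := (mem_flatBag_iff.1 k).resolve_right (notMem_adhesion hw)
  exact congrArg (Sigma.mk _)
    ((TreeDecomposition.top_above h').antisymm (TreeDecomposition.top_above k'))

theorem FlatParent.unique {a b c : N.FlatNode} (h : N.FlatParent a c) (k : N.FlatParent b c) :
    a = b := by
  cases h with
  | inner x y y' h =>
    cases k with
    | inner _ _ y'' k => rw [Option.some.inj (h.symm.trans k)]
    | outer _ _ w k => exact absurd (h.symm.trans k) (by simp)
  | outer x y w h hw hx =>
    cases k with
    | inner _ _ y'' k => exact absurd (k.symm.trans h) (by simp)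
    | outer _ _ w' k hw' hx' => exact flatTop_eq_flatTop (hx' hw) (hx hw')

/-- Going to a parent either goes up in a marginal decomposition or strictly up in the main one. -/
theorem wellFounded_flatParent : WellFounded N.FlatParent := by
  have acc : ∀ x y, Acc N.FlatParent ⟨x, y⟩ := by
    intro x
    induction x using N.main.wf.transGen.induction with
    | _ x ihx =>
      intro y
      induction y using (N.marginal x).wf.induction with
      | _ y ihy =>
        refine ⟨_, fun b hb => ?_⟩
        cases hb with
        | inner _ _ y' h => exact ihy y' h
        | outer _ _ w h hw hx =>
          obtain ⟨p, hp, hwp⟩ := hw.2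
          exact ihx _ (Relation.TransGen.tail' (TreeDecomposition.top_above hwp) hp) _
  exact ⟨fun a => acc a.1 a.2⟩

/-- The adhesion of `x`, if nonempty, is contained in the bag of one of the topmost nodes of its
vertices: in the main decomposition it lies in the bag of some `top u`, and its part in the margin
of `top u` is a clique of the marginal graph, being contained in the adhesion of a child of `top
u`. -/
theorem exists_flatTop_of_adhesion [Finite V] {x : N.main.Node}
    (hne : (N.main.adhesion x).Nonempty) :
    ∃ w ∈ N.main.adhesion x, N.main.adhesion x ⊆ N.flatBag (N.flatTop w) := by
  obtain ⟨v, hv⟩ := hne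
  obtain ⟨p, hp, hvp⟩ := hv.2
  have hxp : N.main.adhesion x ⊆ N.main.bag p := by
    rintro u ⟨-, p', hp', hu⟩
    rwa [Option.some.inj (hp.symm.trans hp')]
  obtain ⟨u, hu, hsub⟩ := TreeDecomposition.exists_top_of_subset_bag ⟨v, hv⟩ hxp
  generalize hb : N.main.top u = b at hsub
  have hbp : N.main.Above b p := hb ▸ TreeDecomposition.top_above (hxp hu)
  have hub : u ∈ N.main.margin b := N.main.mem_margin_iff.2 hb
  -- The child of `b` on the way down to `x` has the whole adhesion of `x` in its own adhesion.
  obtain ⟨c, hbc, hcx⟩ : ∃ c, N.main.parent c = some b ∧ N.main.Above c x := by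
    have h : Relation.TransGen (fun a b => N.main.parent b = some a) b x :=
      Relation.TransGen.tail' hbp hp
    exact (Relation.TransGen.head'_iff).1 h
  have hxc : N.main.adhesion x ⊆ N.main.adhesion c := by
    intro v hv
    have h := TreeDecomposition.top_above (hsub hv)
    exact ⟨TreeDecomposition.mem_bag_of_above (h.tail hbc) hcx hv.1, b, hbc, hsub hv⟩
  obtain ⟨w, hw, hC⟩ := TreeDecomposition.exists_top_of_clique (t := N.marginal b)
    (C := {v | (v : V) ∈ N.main.adhesion x}) (Set.toFinite _) ⟨⟨u, hub⟩, hu⟩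
    (fun v hv v' hv' hne => ⟨hne, Or.inr ⟨c, hbc, hxc hv, hxc hv'⟩⟩)
  refine ⟨w, hw, fun v hv => ?_⟩
  rw [flatTop_eq w.2, mem_flatBag_iff]
  exact (TreeDecomposition.mem_margin_or_mem_adhesion (hsub hv)).imp (fun h => ⟨h, hC hv⟩) id

/-- The flat bags containing `v` have a single topmost node: in the main decomposition, `v` is in
the adhesion of every node of its subtree but the topmost one, and over those nodes all flat bags
contain `v` and have a parent that contains `v` too. -/
theorem isTop_flatBag_iff [Finite V] {v : V} {a : N.FlatNode} :
    (v ∈ N.flatBag a ∧ ∀ b, N.FlatParent b a → v ∉ N.flatBag b) ↔ N.flatTop v = a := by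
  obtain ⟨x, y⟩ := a
  rw [flatTop_eq_iff]
  constructor
  · rintro ⟨h, htop⟩
    rcases mem_flatBag_iff.1 h with ⟨hx, hy⟩ | hx
    · refine ⟨hx, hy, ?_⟩
      rintro ⟨y', hy', hv⟩
      exact htop _ (.inner x y y' hy') (mem_flatBag_iff.2 (Or.inl ⟨hx, hv⟩))
    · exfalso
      cases hy : (N.marginal x).parent y with
      | some y' => exact htop _ (.inner x y y' hy) (mem_flatBag_iff.2 (Or.inr hx))
      | none =>
        obtain ⟨w, hw, hsub⟩ := exists_flatTop_of_adhesion ⟨v, hx⟩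
        exact htop _ (.outer x y w hy hw hsub) (hsub hx)
  · rintro ⟨hx, hy⟩
    refine ⟨mem_flatBag_iff.2 (Or.inl ⟨hx, hy.1⟩), fun b hb hv => ?_⟩
    cases hb with
    | inner _ _ y' h =>
      obtain ⟨_, hv'⟩ := (mem_flatBag_iff.1 hv).resolve_right (notMem_adhesion hx)
      exact hy.2 ⟨y', h, hv'⟩
    | outer _ _ w h hw hsub =>
      obtain ⟨p, hp, hwp⟩ := hw.2
      have hwx : N.main.Above (N.main.top w) p := TreeDecomposition.top_above hwp
      have hxw : N.main.Above x (N.main.top w) := by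
        rw [← N.main.mem_margin_iff.1 hx]
        exact TreeDecomposition.top_above (flatBag_subset_bag _ hv)
      exact N.main.wf.transGen.irrefl.irrefl x (Relation.TransGen.tail' (hxw.trans hwx) hp)

/-- If `v` is the end of an edge `uv` whose topmost node in the main decomposition is the deeper
one, then the bag of `top v` contains `u`: in its margin, where the edge belongs to the marginal
graph, or in its adhesion, which is part of all flat bags over `top v`. -/
theorem exists_mem_flatBag_of_adj {u v : V} (h : G.Adj u v) :
    ∃ a, u ∈ N.flatBag a ∧ v ∈ N.flatBag a := by
  have key : ∀ u v : V, G.Adj u v →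
      u ∈ N.main.bag (N.main.top v) → ∃ a, u ∈ N.flatBag a ∧ v ∈ N.flatBag a := by
    intro u v huv hu
    have hv := N.main.mem_margin_top v
    rcases TreeDecomposition.mem_margin_or_mem_adhesion hu with hu' | hu'
    · obtain ⟨y, h₁, h₂⟩ := (N.marginal (N.main.top v)).edge_mem ⟨u, hu'⟩ ⟨v, hv⟩
        ⟨fun e => huv.ne (congrArg Subtype.val e), Or.inl huv⟩
      exact ⟨⟨_, y⟩, mem_flatBag_iff.2 (Or.inl ⟨hu', h₁⟩), mem_flatBag_iff.2 (Or.inl ⟨hv, h₂⟩)⟩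
    · exact ⟨N.flatTop v, mem_flatBag_iff.2 (Or.inr hu'), mem_flatBag_flatTop v⟩
  obtain ⟨x, hu, hv⟩ := N.main.edge_mem u v h
  have hu' := TreeDecomposition.top_above hu
  have hv' := TreeDecomposition.top_above hv
  rcases hu'.total hv' with k | k
  · exact key u v h (TreeDecomposition.mem_bag_of_above k hv' hu)
  · obtain ⟨a, ha⟩ := key v u h.symm (TreeDecomposition.mem_bag_of_above k hu' hv)
    exact ⟨a, ha.symm⟩

variable (N) in
/-- The tree decomposition obtained by flattening a nested tree decomposition. -/
noncomputable def flatten [Finite V] : TreeDecomposition G :=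
  TreeDecomposition.ofRel N.FlatParent (fun _ _ _ h k => h.unique k) wellFounded_flatParent
    N.flatBag (fun _ _ => exists_mem_flatBag_of_adj) (fun v => by
      simp only [isTop_flatBag_iff]
      exact existsUnique_eq')

theorem flatten_parent [Finite V] {a b : N.FlatNode} :
    N.flatten.parent a = some b ↔ N.FlatParent b a :=
  TreeDecomposition.ofRel_parent _ _ _ _ _ _ a b

/-- Passing from a bag of size `m` to a flat bag adds at most the size of an adhesion; since `m` is
positive, the truncated subtraction in the width does no harm. -/
theorem width_flatten_le [Finite V] : N.flatten.width ≤ N.width := by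
  have := N.main.finite
  rcases isEmpty_or_nonempty N.FlatNode with hemp | hne
  · have h : N.flatten.width = 0 :=
      (congrArg sSup (@Set.range_eq_empty _ _ hemp _)).trans csSup_empty
    exact h ▸ Nat.zero_le _
  · have : Nonempty N.flatten.Node := hne
    refine ciSup_le fun a => ?_
    obtain ⟨x, y⟩ := a
    have := (N.marginal x).finite
    have hbag : ((N.marginal x).bag y).ncard - 1 ≤ (N.marginal x).width :=
      le_ciSup (f := fun y => ((N.marginal x).bag y).ncard - 1) (Set.finite_range _).bddAbove y
    have hx : (N.marginal x).width ≤ ⨆ x, (N.marginal x).width :=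
      le_ciSup (f := fun x => (N.marginal x).width) (Set.finite_range _).bddAbove x
    have hadh : (N.main.adhesion x).ncard ≤ ⨆ x, (N.main.adhesion x).ncard :=
      le_ciSup (f := fun x => (N.main.adhesion x).ncard) (Set.finite_range _).bddAbove x
    have hpos : 0 < ((N.marginal x).bag y).ncard := by
      rw [Set.ncard_pos]
      exact ((N.marginal_sane x).margin_nonempty y).mono (TreeDecomposition.margin_subset_bag y)
    have hunion : (N.flatBag ⟨x, y⟩).ncard ≤
        ((N.marginal x).bag y).ncard + (N.main.adhesion x).ncard :=
      (Set.ncard_union_le _ _).trans (Nat.add_le_add_right (Set.ncard_image_le) _)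
    change (N.flatBag ⟨x, y⟩).ncard - 1 ≤
      (⨆ x, (N.marginal x).width) + ⨆ x, (N.main.adhesion x).ncard
    omega

end NestedTreeDecomposition

/-! ### Tree decompositions as relations on a set -/

/-- The data of a tree decomposition and its graph, with vertices and nodes taken from one set `U`.
`bag v x` says that the vertex `v` is in the bag of the node `x`, and `parent x y` says that `x` is
the parent of `y`. -/
structure RelDecomp (U : Type) where
  vertex : U → Prop
  node : U → Prop
  adj : U → U → Prop
  bag : U → U → Prop
  parent : U → U → Prop
  vertex_of_adj : ∀ {a b}, adj a b → vertex a ∧ vertex b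
  typed_of_bag : ∀ {a b}, bag a b → vertex a ∧ node b
  node_of_parent : ∀ {a b}, parent a b → node a ∧ node b

namespace RelDecomp

variable {U : Type} (R : RelDecomp U)

/-- `R.margin x v` says that `v` is in the margin of `x`. -/
def margin (x v : U) : Prop := R.bag v x ∧ ¬ ∃ y, R.parent y x ∧ R.bag v y

/-- `R.adhesion x v` says that `v` is in the adhesion of `x`. -/
def adhesion (x v : U) : Prop := R.bag v x ∧ ∃ y, R.parent y x ∧ R.bag v y

/-- `R.cone x v` says that `v` is in the cone of `x`. -/
def cone (x v : U) : Prop :=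
  ∃ y, Relation.ReflTransGen (fun a b => R.parent a b) x y ∧ R.bag v y

/-- `R.component x v` says that `v` is in the component of `x`. -/
def component (x v : U) : Prop := R.cone x v ∧ ¬ R.adhesion x v

/-- The set `S` induces a connected subgraph. -/
def ConnectedOn (S : U → Prop) : Prop :=
  (∃ a, S a) ∧
    ∀ a b, S a → S b → Relation.ReflTransGen (fun c d => R.adj c d ∧ S c ∧ S d) a b

/-- The relations form a sane tree decomposition. The connectivity condition on bags is stated in
the form that every vertex lies in exactly one margin. -/
structure IsSane : Prop where
  parent_unique : ∀ a b c, R.parent a c → R.parent b c → a = b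
  wf : WellFounded (fun a b => R.parent a b)
  edge : ∀ u v, R.adj u v → ∃ x, R.bag u x ∧ R.bag v x
  vertex : ∀ v, R.vertex v → ∃ x, R.margin x v ∧ ∀ y, R.margin y v → y = x
  margin_nonempty : ∀ x, R.node x → ∃ v, R.margin x v
  cone_connected : ∀ x, R.node x → R.ConnectedOn (R.cone x)
  component_connected : ∀ x, R.node x → R.ConnectedOn (R.component x)
  adhesion_neighbor : ∀ x v, R.adhesion x v → ∃ u, R.component x u ∧ R.adj v u

variable {V : Type} {G : SimpleGraph V}

/-- The tree decomposition `t` is the relational decomposition `R` up to the namings `ι` of the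
vertices and `ν` of the nodes. -/
structure Realizes (R : RelDecomp U) (t : TreeDecomposition G) (ι : V → U) (ν : t.Node → U) :
    Prop where
  vertex_injective : Function.Injective ι
  node_injective : Function.Injective ν
  vertex : ∀ a, R.vertex a ↔ ∃ v, ι v = a
  node : ∀ a, R.node a ↔ ∃ x, ν x = a
  adj : ∀ u v, R.adj (ι u) (ι v) ↔ G.Adj u v
  bag : ∀ v x, R.bag (ι v) (ν x) ↔ v ∈ t.bag x
  parent : ∀ x y, R.parent (ν x) (ν y) ↔ t.parent y = some x

namespace Realizes

variable {R} {t : TreeDecomposition G} {ι : V → U} {ν : t.Node → U} (h : R.Realizes t ι ν)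
include h

theorem mem_parentBag (v : V) (x : t.Node) :
    (∃ y, R.parent y (ν x) ∧ R.bag (ι v) y) ↔ v ∈ t.parentBag x := by
  constructor
  · rintro ⟨a, ha, hv⟩
    obtain ⟨y, rfl⟩ := (h.node a).1 (R.node_of_parent ha).1
    exact ⟨y, (h.parent _ _).1 ha, (h.bag _ _).1 hv⟩
  · rintro ⟨y, hy, hv⟩
    exact ⟨ν y, (h.parent _ _).2 hy, (h.bag _ _).2 hv⟩

theorem margin (x : t.Node) (v : V) : R.margin (ν x) (ι v) ↔ v ∈ t.margin x :=
  and_congr (h.bag v x) (not_congr (h.mem_parentBag v x))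

theorem adhesion (x : t.Node) (v : V) : R.adhesion (ν x) (ι v) ↔ v ∈ t.adhesion x :=
  and_congr (h.bag v x) (h.mem_parentBag v x)

theorem above_iff (x : t.Node) (b : U) :
    Relation.ReflTransGen (fun a b => R.parent a b) (ν x) b ↔ ∃ y, ν y = b ∧ t.Above x y := by
  constructor
  · intro hb
    induction hb with
    | refl => exact ⟨x, rfl, .refl⟩
    | @tail b c _ hbc ih =>
      obtain ⟨y, rfl, hy⟩ := ih
      obtain ⟨z, rfl⟩ := (h.node c).1 (R.node_of_parent hbc).2
      exact ⟨z, rfl, hy.tail ((h.parent _ _).1 hbc)⟩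
  · rintro ⟨y, rfl, hy⟩
    exact hy.lift ν fun a b hab => (h.parent a b).2 hab

theorem cone (x : t.Node) (v : V) : R.cone (ν x) (ι v) ↔ v ∈ t.cone x := by
  constructor
  · rintro ⟨b, hb, hv⟩
    obtain ⟨y, rfl, hy⟩ := (h.above_iff x b).1 hb
    exact ⟨y, hy, (h.bag _ _).1 hv⟩
  · rintro ⟨y, hy, hv⟩
    exact ⟨ν y, (h.above_iff x _).2 ⟨y, rfl, hy⟩, (h.bag _ _).2 hv⟩

theorem component (x : t.Node) (v : V) : R.component (ν x) (ι v) ↔ v ∈ t.component x :=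
  and_congr (h.cone x v) (not_congr (h.adhesion x v))

theorem connectedOn_iff {S : U → Prop} {T : Set V} (hS : ∀ a, S a → R.vertex a)
    (hST : ∀ v, S (ι v) ↔ v ∈ T) : R.ConnectedOn S ↔ (G.induce T).Connected := by
  constructor
  · rintro ⟨⟨a, ha⟩, hconn⟩
    have lift : ∀ b, Relation.ReflTransGen (fun c d => R.adj c d ∧ S c ∧ S d) a b →
        ∀ (u v : T), ι u = a → ι v = b → (G.induce T).Reachable u v := by
      intro b hb
      induction hb with
      | refl =>
        intro u v hu hv
        rw [Subtype.ext (h.vertex_injective (hu.trans hv.symm))]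
      | @tail b c _ hbc ih =>
        intro u v hu hv
        obtain ⟨w, rfl⟩ := (h.vertex b).1 (hS b hbc.2.1)
        refine (ih u ⟨w, (hST w).1 hbc.2.1⟩ hu rfl).trans (SimpleGraph.Adj.reachable ?_)
        subst hv
        exact (h.adj _ _).1 hbc.1
    obtain ⟨u, rfl⟩ := (h.vertex a).1 (hS a ha)
    have : Nonempty T := ⟨⟨u, (hST u).1 ha⟩⟩
    have reach : ∀ v : T, (G.induce T).Reachable ⟨u, (hST u).1 ha⟩ v := fun v =>
      lift _ (hconn _ _ ha ((hST v).2 v.2)) _ v rfl rfl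
    exact ⟨fun v w => (reach v).symm.trans (reach w)⟩
  · intro hT
    refine ⟨?_, fun a b ha hb => ?_⟩
    · obtain ⟨v⟩ := hT.nonempty
      exact ⟨ι v, (hST v).2 v.2⟩
    · obtain ⟨u, rfl⟩ := (h.vertex a).1 (hS a ha)
      obtain ⟨v, rfl⟩ := (h.vertex b).1 (hS b hb)
      have huv := hT.preconnected ⟨u, (hST u).1 ha⟩ ⟨v, (hST v).1 hb⟩
      rw [SimpleGraph.reachable_iff_reflTransGen] at huv
      exact huv.lift (fun w : T => ι w) fun c d hcd =>
        ⟨(h.adj _ _).2 hcd, (hST c).2 c.2, (hST d).2 d.2⟩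

theorem isSane_iff : R.IsSane ↔ t.Sane := by
  have vertex_of_cone : ∀ x a, R.cone x a → R.vertex a := fun x a ⟨_, _, ha⟩ =>
    (R.typed_of_bag ha).1
  have cone_iff := fun x => h.connectedOn_iff (vertex_of_cone (ν x)) (h.cone x)
  have component_iff := fun x =>
    h.connectedOn_iff (fun a ha => vertex_of_cone (ν x) a ha.1) (h.component x)
  constructor
  · intro hR
    refine ⟨fun x => ?_, fun x => ?_, fun x => ?_, fun x v hv => ?_⟩
    · obtain ⟨a, ha⟩ := hR.margin_nonempty (ν x) ((h.node _).2 ⟨x, rfl⟩)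
      obtain ⟨v, rfl⟩ := (h.vertex a).1 (R.typed_of_bag ha.1).1
      exact ⟨v, (h.margin x v).1 ha⟩
    · exact (cone_iff x).1 (hR.cone_connected (ν x) ((h.node _).2 ⟨x, rfl⟩))
    · exact (component_iff x).1 (hR.component_connected (ν x) ((h.node _).2 ⟨x, rfl⟩))
    · obtain ⟨a, ha, hva⟩ := hR.adhesion_neighbor _ _ ((h.adhesion x v).2 hv)
      obtain ⟨u, rfl⟩ := (h.vertex a).1 (R.vertex_of_adj hva).2
      exact ⟨u, (h.component x u).1 ha, (h.adj _ _).1 hva⟩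
  · intro ht
    refine ⟨?_, ?_, ?_, ?_, ?_, ?_, ?_, ?_⟩
    · intro a b c hac hbc
      obtain ⟨x, rfl⟩ := (h.node a).1 (R.node_of_parent hac).1
      obtain ⟨y, rfl⟩ := (h.node b).1 (R.node_of_parent hbc).1
      obtain ⟨z, rfl⟩ := (h.node c).1 (R.node_of_parent hbc).2
      rw [Option.some.inj (((h.parent _ _).1 hac).symm.trans ((h.parent _ _).1 hbc))]
    · have acc : ∀ x, Acc (fun a b => R.parent a b) (ν x) := by
        intro x
        induction x using t.wf.induction with
        | _ x ih =>
          refine ⟨_, fun b hb => ?_⟩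
          obtain ⟨y, rfl⟩ := (h.node b).1 (R.node_of_parent hb).1
          exact ih y ((h.parent _ _).1 hb)
      refine ⟨fun a => ⟨_, fun b hb => ?_⟩⟩
      obtain ⟨y, rfl⟩ := (h.node b).1 (R.node_of_parent hb).1
      exact acc y
    · intro a b hab
      obtain ⟨u, rfl⟩ := (h.vertex a).1 (R.vertex_of_adj hab).1
      obtain ⟨v, rfl⟩ := (h.vertex b).1 (R.vertex_of_adj hab).2
      obtain ⟨x, hu, hv⟩ := t.edge_mem u v ((h.adj _ _).1 hab)
      exact ⟨ν x, (h.bag _ _).2 hu, (h.bag _ _).2 hv⟩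
    · intro a ha
      obtain ⟨v, rfl⟩ := (h.vertex a).1 ha
      refine ⟨ν (t.top v), (h.margin _ _).2 (t.mem_margin_top v), fun b hb => ?_⟩
      obtain ⟨y, rfl⟩ := (h.node b).1 (R.typed_of_bag hb.1).2
      rw [t.mem_margin_iff.1 ((h.margin _ _).1 hb)]
    · intro a ha
      obtain ⟨x, rfl⟩ := (h.node a).1 ha
      obtain ⟨v, hv⟩ := ht.margin_nonempty x
      exact ⟨ι v, (h.margin _ _).2 hv⟩
    · intro a ha
      obtain ⟨x, rfl⟩ := (h.node a).1 ha
      exact (cone_iff x).2 (ht.cone_connected x)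
    · intro a ha
      obtain ⟨x, rfl⟩ := (h.node a).1 ha
      exact (component_iff x).2 (ht.component_connected x)
    · intro a b hb
      obtain ⟨x, rfl⟩ := (h.node a).1 (R.typed_of_bag hb.1).2
      obtain ⟨v, rfl⟩ := (h.vertex b).1 (R.typed_of_bag hb.1).1
      obtain ⟨u, hu, hvu⟩ := ht.adhesion_neighbor x v ((h.adhesion _ _).1 hb)
      exact ⟨ι u, (h.component _ _).2 hu, (h.adj _ _).2 hvu⟩

end Realizes

variable {R}

/-- A sane relational decomposition comes from a sane tree decomposition of any graph isomorphic to
the one it describes. -/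
theorem IsSane.exists_realizes [Finite U] (hR : R.IsSane) {ι : V → U}
    (hι : Function.Injective ι) (hvertex : ∀ a, R.vertex a ↔ ∃ v, ι v = a)
    (hadj : ∀ u v, R.adj (ι u) (ι v) ↔ G.Adj u v) :
    ∃ (t : TreeDecomposition G) (ν : t.Node → U), R.Realizes t ι ν ∧ t.Sane := by
  have margin_iff : ∀ (v : V) (x : {x // R.node x}), R.margin x (ι v) ↔
      (R.bag (ι v) x ∧ ∀ y : {x // R.node x}, R.parent y x → ¬ R.bag (ι v) y) := by
    refine fun v x => and_congr Iff.rfl ⟨fun h y hy hv => h ⟨y, hy, hv⟩, ?_⟩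
    rintro h ⟨y, hy, hv⟩
    exact h ⟨y, (R.node_of_parent hy).1⟩ hy hv
  have hedge : ∀ u v, G.Adj u v → ∃ x : {x // R.node x}, R.bag (ι u) x ∧ R.bag (ι v) x := by
    intro u v huv
    obtain ⟨x, hu, hv⟩ := hR.edge _ _ ((hadj u v).2 huv)
    exact ⟨⟨x, (R.typed_of_bag hu).2⟩, hu, hv⟩
  have htop : ∀ v, ∃! x : {x // R.node x},
      R.bag (ι v) x ∧ ∀ y : {x // R.node x}, R.parent y x → ¬ R.bag (ι v) y := by
    intro v
    obtain ⟨x, hx, huniq⟩ := hR.vertex (ι v) ((hvertex _).2 ⟨v, rfl⟩)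
    refine ⟨⟨x, (R.typed_of_bag hx.1).2⟩, (margin_iff v ⟨x, _⟩).1 hx, fun y hy => ?_⟩
    exact Subtype.ext (huniq y ((margin_iff v y).2 hy))
  have hpar : ∀ a b c : {x // R.node x}, R.parent a c → R.parent b c → a = b :=
    fun a b c ha hb => Subtype.ext (hR.parent_unique _ _ _ ha hb)
  have hwf : WellFounded fun a b : {x // R.node x} => R.parent a b := InvImage.wf Subtype.val hR.wf
  let t : TreeDecomposition G :=
    TreeDecomposition.ofRel _ hpar hwf (fun x => {v | R.bag (ι v) x}) hedge htop
  have ht : R.Realizes t ι Subtype.val :=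
    { vertex_injective := hι
      node_injective := Subtype.val_injective
      vertex := hvertex
      node := fun a => ⟨fun ha => ⟨⟨a, ha⟩, rfl⟩, fun ⟨x, hx⟩ => hx ▸ x.2⟩
      adj := hadj
      bag := fun _ _ => Iff.rfl
      parent := fun x y => (TreeDecomposition.ofRel_parent _ hpar hwf _ hedge htop y x).symm }
  exact ⟨t, Subtype.val, ht, ht.isSane_iff.1 hR⟩

end RelDecomp

/-! ### Definability of sanity -/

namespace RelDecomp

open MSO

variable {S : Vocabulary} {p : ℕ}

/-- The relations of a family of relational decompositions, depending on a structure and on `p` of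
its elements, are definable. -/
structure DefinableFamily (R : ∀ A : Struct S, (Fin p → A.carrier) → RelDecomp A.carrier) :
    Prop where
  vertex : ∀ {n m : ℕ} (ρ : Fin p → Fin n) (i : Fin n),
    Definable (m := m) fun A v _ => (R A fun k => v (ρ k)).vertex (v i)
  node : ∀ {n m : ℕ} (ρ : Fin p → Fin n) (i : Fin n),
    Definable (m := m) fun A v _ => (R A fun k => v (ρ k)).node (v i)
  adj : ∀ {n m : ℕ} (ρ : Fin p → Fin n) (i j : Fin n),
    Definable (m := m) fun A v _ => (R A fun k => v (ρ k)).adj (v i) (v j)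
  bag : ∀ {n m : ℕ} (ρ : Fin p → Fin n) (i j : Fin n),
    Definable (m := m) fun A v _ => (R A fun k => v (ρ k)).bag (v i) (v j)
  parent : ∀ {n m : ℕ} (ρ : Fin p → Fin n) (i j : Fin n),
    Definable (m := m) fun A v _ => (R A fun k => v (ρ k)).parent (v i) (v j)

namespace DefinableFamily

variable {R : ∀ A : Struct S, (Fin p → A.carrier) → RelDecomp A.carrier} (hR : DefinableFamily R)
  {n m : ℕ} (ρ : Fin p → Fin n)
include hR

theorem margin (i j : Fin n) :
    Definable (m := m) fun A v _ => (R A fun k => v (ρ k)).margin (v i) (v j) :=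
  (hR.bag ρ j i).and (Definable.ex ((hR.parent _ _ _).and (hR.bag _ _ _))).not

theorem adhesion (i j : Fin n) :
    Definable (m := m) fun A v _ => (R A fun k => v (ρ k)).adhesion (v i) (v j) :=
  (hR.bag ρ j i).and (Definable.ex ((hR.parent _ _ _).and (hR.bag _ _ _)))

theorem cone (i j : Fin n) :
    Definable (m := m) fun A v _ => (R A fun k => v (ρ k)).cone (v i) (v j) :=
  Definable.ex ((Definable.reflTransGen (hR.parent (fun k => (ρ k).succ.succ.succ) _ _)
    (Fin.succ i) 0).and (hR.bag _ _ _))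

theorem component (i j : Fin n) :
    Definable (m := m) fun A v _ => (R A fun k => v (ρ k)).component (v i) (v j) :=
  (hR.cone ρ i j).and (hR.adhesion ρ i j).not

/-- Connectedness of a definable set is definable. As there is no substitution of variables at hand,
the definability of the set is required in each of the contexts in which it is used: below the
existential quantifier, below the two universal ones, and inside the transitive closure. -/
theorem connectedOn
    {S' : ∀ A : Struct S, (Fin n → A.carrier) → A.carrier → Prop}
    (h₀ : Definable (n := n + 1) (m := m) fun A w _ => S' A (fun i => w i.succ) (w 0))
    (h : ∀ {m : ℕ} (i : Fin (n + 1 + 1)),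
      Definable (n := n + 1 + 1) (m := m) fun A w _ => S' A (fun i => w i.succ.succ) (w i))
    (h' : ∀ {m : ℕ} (i : Fin (n + 1 + 1 + 1 + 1)),
      Definable (n := n + 1 + 1 + 1 + 1) (m := m) fun A w _ =>
        S' A (fun i => w i.succ.succ.succ.succ) (w i)) :
    Definable (m := m) fun A v _ => (R A fun k => v (ρ k)).ConnectedOn (S' A v) :=
  (Definable.ex h₀).and (Definable.all (Definable.all ((h _).imp ((h _).imp
    (Definable.reflTransGen ((hR.adj (fun k => (ρ k).succ.succ.succ.succ) _ _).and
      ((h' _).and (h' _))) (Fin.succ 0) 0)))))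

theorem isSane : Definable (m := m) fun A v _ => (R A fun k => v (ρ k)).IsSane := by
  refine Definable.congr (P := fun A v _ =>
    (∀ a b c, (R A fun k => v (ρ k)).parent a c → (R A fun k => v (ρ k)).parent b c → a = b) ∧
    WellFounded (fun a b => (R A fun k => v (ρ k)).parent a b) ∧
    (∀ a b, (R A fun k => v (ρ k)).adj a b →
      ∃ x, (R A fun k => v (ρ k)).bag a x ∧ (R A fun k => v (ρ k)).bag b x) ∧
    (∀ a, (R A fun k => v (ρ k)).vertex a → ∃ x, (R A fun k => v (ρ k)).margin x a ∧
      ∀ y, (R A fun k => v (ρ k)).margin y a → y = x) ∧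
    (∀ x, (R A fun k => v (ρ k)).node x → ∃ a, (R A fun k => v (ρ k)).margin x a) ∧
    (∀ x, (R A fun k => v (ρ k)).node x →
      (R A fun k => v (ρ k)).ConnectedOn ((R A fun k => v (ρ k)).cone x)) ∧
    (∀ x, (R A fun k => v (ρ k)).node x →
      (R A fun k => v (ρ k)).ConnectedOn ((R A fun k => v (ρ k)).component x)) ∧
    (∀ x a, (R A fun k => v (ρ k)).adhesion x a → ∃ u, (R A fun k => v (ρ k)).component x u ∧
      (R A fun k => v (ρ k)).adj a u)) ?_
    (fun A v _ => ⟨fun ⟨h₁, h₂, h₃, h₄, h₅, h₆, h₇, h₈⟩ => ⟨h₁, h₂, h₃, h₄, h₅, h₆, h₇, h₈⟩,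
      fun ⟨h₁, h₂, h₃, h₄, h₅, h₆, h₇, h₈⟩ => ⟨h₁, h₂, h₃, h₄, h₅, h₆, h₇, h₈⟩⟩)
  refine .and ?_ (.and ?_ (.and ?_ (.and ?_ (.and ?_ (.and ?_ (.and ?_ ?_))))))
  · exact .all (.all (.all (.imp (hR.parent _ _ _) (.imp (hR.parent _ _ _) (.eq _ _)))))
  · exact .wellFounded (hR.parent _ _ _)
  · exact .all (.all (.imp (hR.adj _ _ _) (.ex (.and (hR.bag _ _ _) (hR.bag _ _ _)))))
  · exact .all (.imp (hR.vertex _ _) (.ex (.and (hR.margin _ _ _)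
      (.all (.imp (hR.margin _ _ _) (.eq _ _))))))
  · exact .all (.imp (hR.node _ _) (.ex (hR.margin _ _ _)))
  · exact .all (.imp (hR.node _ _) (hR.connectedOn (fun k => (ρ k).succ)
      (S' := fun A w => (R A fun k => w (ρ k).succ).cone (w 0))
      (hR.cone _ (Fin.succ 0) 0) (hR.cone _ (Fin.succ (Fin.succ 0)))
      (hR.cone _ (Fin.succ (Fin.succ (Fin.succ (Fin.succ 0)))))))
  · exact .all (.imp (hR.node _ _) (hR.connectedOn (fun k => (ρ k).succ)
      (S' := fun A w => (R A fun k => w (ρ k).succ).component (w 0))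
      (hR.component _ (Fin.succ 0) 0) (hR.component _ (Fin.succ (Fin.succ 0)))
      (hR.component _ (Fin.succ (Fin.succ (Fin.succ (Fin.succ 0)))))))
  · exact .all (.all (.imp (hR.adhesion _ _ _) (.ex (.and (hR.component _ _ _) (hR.adj _ _ _)))))

end DefinableFamily

end RelDecomp

/-! ### Axioms for encodings of nested tree decompositions -/

namespace NestedTreeDecomposition

section Axioms

variable {U : Type} (P : RelName → U → U → Prop)

/-- Vertices of the graph underlying the main decomposition. -/
def IsMainVertex (v : U) : Prop := (∃ x, P .bag v x) ∧ ¬ ∃ u, P .same u v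

/-- Nodes of the main decomposition. -/
def IsMainNode (x : U) : Prop := (∃ v, P .bag v x) ∧ ¬ ∃ y, P .marginal x y

/-- The main decomposition, as a relational decomposition. -/
def relMain : RelDecomp U where
  vertex := IsMainVertex P
  node := IsMainNode P
  adj u v := (IsMainVertex P u ∧ IsMainVertex P v) ∧ ¬ u = v ∧
    ∃ e, P .incident u e ∧ P .incident v e
  bag v x := (IsMainVertex P v ∧ IsMainNode P x) ∧ P .bag v x
  parent x y := (IsMainNode P x ∧ IsMainNode P y) ∧ P .parent x y
  vertex_of_adj h := h.1
  typed_of_bag h := h.1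
  node_of_parent h := h.1

/-- The marginal decomposition of the node `x`, as a relational decomposition. Its vertices are not
the copies but the original vertices in the margin of `x`, and adjacency in the marginal graph is
read off the main decomposition. -/
def relMarginal (x : U) : RelDecomp U where
  vertex v := (relMain P).margin x v
  node y := P .marginal y x
  adj u v := ((relMain P).margin x u ∧ (relMain P).margin x v) ∧ ¬ u = v ∧
    ((relMain P).adj u v ∨
      ∃ y, (relMain P).parent x y ∧ (relMain P).adhesion y u ∧ (relMain P).adhesion y v)
  bag v y := ((relMain P).margin x v ∧ P .marginal y x) ∧ ∃ v', P .same v v' ∧ P .bag v' y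
  parent y z := (P .marginal y x ∧ P .marginal z x) ∧ P .parent y z
  vertex_of_adj h := h.1
  typed_of_bag h := h.1
  node_of_parent h := h.1

/-- Axioms that hold exactly in the structures isomorphic to encodings of nested tree
decompositions: the main decomposition and all marginal decompositions are sane, `same` is a
bijection from the vertices of the main decomposition to their copies, the edges of each graph are
represented by unique elements, and the relations respect the sorts of the elements. -/
structure IsEncoding : Prop where
  main_sane : (relMain P).IsSane
  marginal_sane : ∀ x, IsMainNode P x → (relMarginal P x).IsSane
  exhaustive : ∀ a, (∃ x, P .bag a x) ∨ (∃ v, P .bag v a) ∨ ∃ v, P .incident v a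
  vertex_or_node : ∀ a, (∃ x, P .bag a x) → ¬ ∃ v, P .bag v a
  vertex_or_edge : ∀ a, (∃ x, P .bag a x) → ¬ ∃ v, P .incident v a
  node_or_edge : ∀ a, (∃ v, P .bag v a) → ¬ ∃ v, P .incident v a
  vertex_of_same : ∀ u v, P .same u v → ∃ x, P .bag v x
  node_of_marginal : ∀ y x, P .marginal y x → ∃ v, P .bag v y
  bag_typed : ∀ v y, P .bag v y → (IsMainVertex P v ∧ IsMainNode P y) ∨
    ∃ u x, P .same u v ∧ P .marginal y x ∧ (relMain P).margin x u
  parent_typed : ∀ x y, P .parent x y → (IsMainNode P x ∧ IsMainNode P y) ∨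
    ∃ z, P .marginal x z ∧ P .marginal y z
  marginal_typed : ∀ y x, P .marginal y x → IsMainNode P x
  marginal_unique : ∀ y x x', P .marginal y x → P .marginal y x' → x = x'
  same_typed : ∀ u v, P .same u v → IsMainVertex P u
  same_exists : ∀ u, IsMainVertex P u → ∃ v, P .same u v
  same_unique : ∀ u v v', P .same u v → P .same u v' → v = v'
  same_injective : ∀ u u' v, P .same u v → P .same u' v → u = u'
  edge_ends : ∀ v e, P .incident v e → ∃ w, ¬ v = w ∧ P .incident w e ∧
    (∀ z, P .incident z e → z = v ∨ z = w) ∧ ((IsMainVertex P v ∧ IsMainVertex P w) ∨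
      ∃ u u' x, P .same u v ∧ P .same u' w ∧ (relMarginal P x).adj u u')
  edge_exists : ∀ x u u' v v', (relMarginal P x).adj u u' → P .same u v → P .same u' v' →
    ∃ e, P .incident v e ∧ P .incident v' e
  edge_unique : ∀ v w e e', ¬ v = w → P .incident v e → P .incident w e → P .incident v e' →
    P .incident w e' → e = e'

variable {P} {V : Type} {G : SimpleGraph V} {t : TreeDecomposition G} {ι : V → U} {ν : t.Node → U}

theorem relMarginal_vertex_iff (h : (relMain P).Realizes t ι ν) (x : t.Node) (a : U) :
    (relMarginal P (ν x)).vertex a ↔ ∃ v : t.margin x, ι v = a := by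
  constructor
  · intro ha
    obtain ⟨v, rfl⟩ := (h.vertex a).1 ((relMain P).typed_of_bag ha.1).1
    exact ⟨⟨v, (h.margin x v).1 ha⟩, rfl⟩
  · rintro ⟨v, rfl⟩
    exact (h.margin x v).2 v.2

theorem relMarginal_adj_iff (h : (relMain P).Realizes t ι ν) (x : t.Node) (u v : t.margin x) :
    (relMarginal P (ν x)).adj (ι u) (ι v) ↔ (t.marginalGraph x).Adj u v := by
  constructor
  · rintro ⟨-, hne, hadj⟩
    refine ⟨fun e => hne (by rw [e]), hadj.imp (h.adj _ _).1 ?_⟩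
    rintro ⟨a, ha, hu, hv⟩
    obtain ⟨y, rfl⟩ := (h.node a).1 ((relMain P).node_of_parent ha).2
    exact ⟨y, (h.parent _ _).1 ha, (h.adhesion _ _).1 hu, (h.adhesion _ _).1 hv⟩
  · rintro ⟨hne, hadj⟩
    refine ⟨⟨(h.margin x u).2 u.2, (h.margin x v).2 v.2⟩,
      fun e => hne (Subtype.ext (h.vertex_injective e)), hadj.imp (h.adj _ _).2 ?_⟩
    rintro ⟨y, hy, hu, hv⟩
    exact ⟨ν y, (h.parent _ _).2 hy, (h.adhesion _ _).2 hu, (h.adhesion _ _).2 hv⟩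

end Axioms

/-! ### Encodings satisfy the axioms -/

variable {V : Type} {G : SimpleGraph V} (N : NestedTreeDecomposition G)

theorem holds_incident_iff (a b : N.Elem) : N.Holds .incident a b ↔
    (∃ v e, a = .main (.vertex v) ∧ b = .main (.edge e) ∧ v ∈ (e : Sym2 V)) ∨
      ∃ x v e, a = .marginal x (.vertex v) ∧ b = .marginal x (.edge e) ∧ v ∈ (e : Sym2 _) := by
  constructor
  · intro h
    generalize hr : RelName.incident = r at h
    cases h with
    | ofMain R a b h =>
      cases h with
      | incident v e h => exact Or.inl ⟨v, e, rfl, rfl, h⟩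
      | _ => cases hr
    | ofMarginal R x a b h =>
      cases h with
      | incident v e h => exact Or.inr ⟨x, v, e, rfl, rfl, h⟩
      | _ => cases hr
    | _ => cases hr
  · rintro (⟨v, e, rfl, rfl, h⟩ | ⟨x, v, e, rfl, rfl, h⟩)
    · exact .ofMain .incident _ _ (.incident v e h)
    · exact .ofMarginal .incident x _ _ (.incident v e h)

theorem holds_bag_iff (a b : N.Elem) : N.Holds .bag a b ↔
    (∃ v x, a = .main (.vertex v) ∧ b = .main (.node x) ∧ v ∈ N.main.bag x) ∨
      ∃ x v y, a = .marginal x (.vertex v) ∧ b = .marginal x (.node y) ∧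
        v ∈ (N.marginal x).bag y := by
  constructor
  · intro h
    generalize hr : RelName.bag = r at h
    cases h with
    | ofMain R a b h =>
      cases h with
      | bag v x h => exact Or.inl ⟨v, x, rfl, rfl, h⟩
      | _ => cases hr
    | ofMarginal R x a b h =>
      cases h with
      | bag v y h => exact Or.inr ⟨x, v, y, rfl, rfl, h⟩
      | _ => cases hr
    | _ => cases hr
  · rintro (⟨v, x, rfl, rfl, h⟩ | ⟨x, v, y, rfl, rfl, h⟩)
    · exact .ofMain .bag _ _ (.bag v x h)
    · exact .ofMarginal .bag x _ _ (.bag v y h)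

theorem holds_parent_iff (a b : N.Elem) : N.Holds .parent a b ↔
    (∃ x y, a = .main (.node x) ∧ b = .main (.node y) ∧ N.main.parent y = some x) ∨
      ∃ x y z, a = .marginal x (.node y) ∧ b = .marginal x (.node z) ∧
        (N.marginal x).parent z = some y := by
  constructor
  · intro h
    generalize hr : RelName.parent = r at h
    cases h with
    | ofMain R a b h =>
      cases h with
      | parent x y h => exact Or.inl ⟨x, y, rfl, rfl, h⟩
      | _ => cases hr
    | ofMarginal R x a b h =>
      cases h with
      | parent y z h => exact Or.inr ⟨x, y, z, rfl, rfl, h⟩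
      | _ => cases hr
    | _ => cases hr
  · rintro (⟨x, y, rfl, rfl, h⟩ | ⟨x, y, z, rfl, rfl, h⟩)
    · exact .ofMain .parent _ _ (.parent x y h)
    · exact .ofMarginal .parent x _ _ (.parent y z h)

theorem holds_same_iff (a b : N.Elem) : N.Holds .same a b ↔
    ∃ x, ∃ v : N.main.margin x, a = .main (.vertex v) ∧ b = .marginal x (.vertex v) := by
  constructor
  · intro h
    generalize hr : RelName.same = r at h
    cases h with
    | ofMain R => cases R <;> cases hr
    | ofMarginal R => cases R <;> cases hr
    | same x v => exact ⟨x, v, rfl, rfl⟩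
    | marginal => cases hr
  · rintro ⟨x, v, rfl, rfl⟩
    exact .same x v

theorem holds_marginal_iff (a b : N.Elem) : N.Holds .marginal a b ↔
    ∃ x y, a = .marginal x (.node y) ∧ b = .main (.node x) := by
  constructor
  · intro h
    generalize hr : RelName.marginal = r at h
    cases h with
    | ofMain R => cases R <;> cases hr
    | ofMarginal R => cases R <;> cases hr
    | same => cases hr
    | marginal x y => exact ⟨x, y, rfl, rfl⟩
  · rintro ⟨x, y, rfl, rfl⟩
    exact .marginal x y

theorem isMainVertex_holds_iff (a : N.Elem) :
    IsMainVertex N.Holds a ↔ ∃ v, .main (.vertex v) = a := by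
  constructor
  · rintro ⟨⟨b, hb⟩, hne⟩
    rcases (N.holds_bag_iff _ _).1 hb with ⟨v, x, rfl, -, -⟩ | ⟨x, v, y, rfl, -, -⟩
    · exact ⟨v, rfl⟩
    · exact absurd ⟨_, .same x v⟩ hne
  · rintro ⟨v, rfl⟩
    refine ⟨⟨.main (.node (N.main.top v)), (N.holds_bag_iff _ _).2
      (Or.inl ⟨v, _, rfl, rfl, (N.main.mem_margin_top v).1⟩)⟩, ?_⟩
    rintro ⟨u, hu⟩
    obtain ⟨_, _, -, h⟩ := (N.holds_same_iff _ _).1 hu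
    cases h

theorem isMainNode_holds_iff (a : N.Elem) :
    IsMainNode N.Holds a ↔ ∃ x, .main (.node x) = a := by
  constructor
  · rintro ⟨⟨b, hb⟩, hne⟩
    rcases (N.holds_bag_iff _ _).1 hb with ⟨v, x, -, rfl, -⟩ | ⟨x, v, y, -, rfl, -⟩
    · exact ⟨x, rfl⟩
    · exact absurd ⟨_, .marginal x y⟩ hne
  · rintro ⟨x, rfl⟩
    obtain ⟨v, hv⟩ := N.main_sane.margin_nonempty x
    refine ⟨⟨.main (.vertex v), (N.holds_bag_iff _ _).2 (Or.inl ⟨v, x, rfl, rfl, hv.1⟩)⟩, ?_⟩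
    rintro ⟨u, hu⟩
    obtain ⟨_, _, h, -⟩ := (N.holds_marginal_iff _ _).1 hu
    cases h

theorem realizes_main : (relMain N.Holds).Realizes N.main
    (fun v => .main (.vertex v)) (fun x => .main (.node x)) where
  vertex_injective _ _ h := by cases h; rfl
  node_injective _ _ h := by cases h; rfl
  vertex := N.isMainVertex_holds_iff
  node := N.isMainNode_holds_iff
  adj u v := by
    constructor
    · rintro ⟨-, hne, b, hu, hv⟩
      rcases (N.holds_incident_iff _ _).1 hu with ⟨_, e, ⟨⟩, rfl, hu'⟩ | ⟨_, _, _, ⟨⟩, -, -⟩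
      rcases (N.holds_incident_iff _ _).1 hv with ⟨_, _, ⟨⟩, ⟨⟩, hv'⟩ | ⟨_, _, _, ⟨⟩, -, -⟩
      have huv : u ≠ v := fun h => hne (by rw [h])
      have he : (e : Sym2 V) = s(u, v) := (Sym2.mem_and_mem_iff huv).1 ⟨hu', hv'⟩
      exact (SimpleGraph.mem_edgeSet G).1 (he ▸ e.2)
    · intro h
      refine ⟨⟨(N.isMainVertex_holds_iff _).2 ⟨u, rfl⟩, (N.isMainVertex_holds_iff _).2 ⟨v, rfl⟩⟩,
        ?_, .main (.edge ⟨s(u, v), h⟩), ?_, ?_⟩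
      · intro e
        cases e
        exact h.ne rfl
      · exact (N.holds_incident_iff _ _).2 (Or.inl ⟨u, _, rfl, rfl, Sym2.mem_mk_left u v⟩)
      · exact (N.holds_incident_iff _ _).2 (Or.inl ⟨v, _, rfl, rfl, Sym2.mem_mk_right u v⟩)
  bag v x := by
    constructor
    · rintro ⟨-, h⟩
      rcases (N.holds_bag_iff _ _).1 h with ⟨_, _, ⟨⟩, ⟨⟩, h⟩ | ⟨_, _, _, ⟨⟩, -, -⟩
      exact h
    · intro h
      exact ⟨⟨(N.isMainVertex_holds_iff _).2 ⟨v, rfl⟩, (N.isMainNode_holds_iff _).2 ⟨x, rfl⟩⟩,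
        (N.holds_bag_iff _ _).2 (Or.inl ⟨v, x, rfl, rfl, h⟩)⟩
  parent x y := by
    constructor
    · rintro ⟨-, h⟩
      rcases (N.holds_parent_iff _ _).1 h with ⟨_, _, ⟨⟩, ⟨⟩, h⟩ | ⟨_, _, _, ⟨⟩, -, -⟩
      exact h
    · intro h
      exact ⟨⟨(N.isMainNode_holds_iff _).2 ⟨x, rfl⟩, (N.isMainNode_holds_iff _).2 ⟨y, rfl⟩⟩,
        (N.holds_parent_iff _ _).2 (Or.inl ⟨x, y, rfl, rfl, h⟩)⟩

/-- The marginal decompositions are realized by the original vertices instead of their copies. -/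
theorem realizes_marginal (x : N.main.Node) :
    (relMarginal N.Holds (.main (.node x))).Realizes (N.marginal x)
      (fun v => .main (.vertex (v : V))) (fun y => .marginal x (.node y)) where
  vertex_injective u v h := by
    have h' : (u : V) = v := by injection h with h; injection h
    exact Subtype.ext h'
  node_injective _ _ h := by cases h; rfl
  vertex := relMarginal_vertex_iff N.realizes_main x
  node a := by
    constructor
    · intro h
      obtain ⟨_, y, rfl, ⟨⟩⟩ := (N.holds_marginal_iff _ _).1 h
      exact ⟨y, rfl⟩
    · rintro ⟨y, rfl⟩
      exact .marginal x y
  adj := relMarginal_adj_iff N.realizes_main x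
  bag v y := by
    constructor
    · rintro ⟨-, a, hv, ha⟩
      obtain ⟨x', v', h, rfl⟩ := (N.holds_same_iff _ _).1 hv
      rcases (N.holds_bag_iff _ _).1 ha with ⟨_, _, ⟨⟩, -, -⟩ | ⟨_, _, _, ⟨⟩, ⟨⟩, h'⟩
      have hv' : (v : V) = v' := by injection h with h; injection h
      rwa [Subtype.ext hv']
    · intro h
      exact ⟨⟨(N.realizes_main.margin x v).2 v.2, .marginal x y⟩, _, .same x v,
        (N.holds_bag_iff _ _).2 (Or.inr ⟨x, v, y, rfl, rfl, h⟩)⟩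
  parent y z := by
    constructor
    · rintro ⟨-, h⟩
      rcases (N.holds_parent_iff _ _).1 h with ⟨_, _, ⟨⟩, -, -⟩ | ⟨_, _, _, ⟨⟩, ⟨⟩, h⟩
      exact h
    · intro h
      exact ⟨⟨.marginal x y, .marginal x z⟩,
        (N.holds_parent_iff _ _).2 (Or.inr ⟨x, y, z, rfl, rfl, h⟩)⟩

theorem exists_eq_mk_of_mem_edgeSet {W : Type} {H : SimpleGraph W} (e : H.edgeSet) {v : W}
    (hv : v ∈ (e : Sym2 W)) : ∃ w, (e : Sym2 W) = s(v, w) ∧ H.Adj v w := by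
  obtain ⟨w, hw⟩ := Sym2.mem_iff_exists.1 hv
  exact ⟨w, hw, (SimpleGraph.mem_edgeSet H).1 (hw ▸ e.2)⟩

theorem isEncoding_holds : IsEncoding N.Holds where
  main_sane := N.realizes_main.isSane_iff.2 N.main_sane
  marginal_sane a ha := by
    obtain ⟨x, rfl⟩ := (N.isMainNode_holds_iff a).1 ha
    exact (N.realizes_marginal x).isSane_iff.2 (N.marginal_sane x)
  exhaustive a := by
    have bag_main := fun v x h => (N.holds_bag_iff _ _).2 (Or.inl ⟨v, x, rfl, rfl, h⟩)
    have bag_marginal := fun x v y h => (N.holds_bag_iff _ _).2 (Or.inr ⟨x, v, y, rfl, rfl, h⟩)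
    rcases a with (v | e | x) | ⟨x, v | e | y⟩
    · exact Or.inl ⟨_, bag_main v _ (N.main.mem_margin_top v).1⟩
    · have hv := Sym2.out_fst_mem (e : Sym2 V)
      exact Or.inr (Or.inr ⟨_, (N.holds_incident_iff _ _).2 (Or.inl ⟨_, e, rfl, rfl, hv⟩)⟩)
    · obtain ⟨v, hv⟩ := N.main_sane.margin_nonempty x
      exact Or.inr (Or.inl ⟨_, bag_main v x hv.1⟩)
    · exact Or.inl ⟨_, bag_marginal x v _ ((N.marginal x).mem_margin_top v).1⟩
    · have hv := Sym2.out_fst_mem (e : Sym2 (N.main.margin x))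
      exact Or.inr (Or.inr ⟨_, (N.holds_incident_iff _ _).2 (Or.inr ⟨x, _, e, rfl, rfl, hv⟩)⟩)
    · obtain ⟨v, hv⟩ := (N.marginal_sane x).margin_nonempty y
      exact Or.inr (Or.inl ⟨_, bag_marginal x v y hv.1⟩)
  vertex_or_node := by
    rintro a ⟨b, hb⟩ ⟨c, hc⟩
    rw [holds_bag_iff] at hb hc
    rcases hb with ⟨_, _, rfl, -, -⟩ | ⟨_, _, _, rfl, -, -⟩ <;>
    rcases hc with ⟨_, _, -, ⟨⟩, -⟩ | ⟨_, _, _, -, ⟨⟩, -⟩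
  vertex_or_edge := by
    rintro a ⟨b, hb⟩ ⟨c, hc⟩
    rw [holds_bag_iff] at hb
    rw [holds_incident_iff] at hc
    rcases hb with ⟨_, _, rfl, -, -⟩ | ⟨_, _, _, rfl, -, -⟩ <;>
    rcases hc with ⟨_, _, -, ⟨⟩, -⟩ | ⟨_, _, _, -, ⟨⟩, -⟩
  node_or_edge := by
    rintro a ⟨b, hb⟩ ⟨c, hc⟩
    rw [holds_bag_iff] at hb
    rw [holds_incident_iff] at hc
    rcases hb with ⟨_, _, -, rfl, -⟩ | ⟨_, _, _, -, rfl, -⟩ <;>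
    rcases hc with ⟨_, _, -, ⟨⟩, -⟩ | ⟨_, _, _, -, ⟨⟩, -⟩
  vertex_of_same := by
    intro a b h
    obtain ⟨x, v, rfl, rfl⟩ := (N.holds_same_iff _ _).1 h
    exact ⟨_, (N.holds_bag_iff _ _).2
      (Or.inr ⟨x, v, _, rfl, rfl, ((N.marginal x).mem_margin_top v).1⟩)⟩
  node_of_marginal := by
    intro a b h
    obtain ⟨x, y, rfl, rfl⟩ := (N.holds_marginal_iff _ _).1 h
    obtain ⟨v, hv⟩ := (N.marginal_sane x).margin_nonempty y
    exact ⟨_, (N.holds_bag_iff _ _).2 (Or.inr ⟨x, v, y, rfl, rfl, hv.1⟩)⟩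
  bag_typed := by
    intro a b h
    rcases (N.holds_bag_iff _ _).1 h with ⟨v, x, rfl, rfl, -⟩ | ⟨x, v, y, rfl, rfl, -⟩
    · exact Or.inl ⟨(N.isMainVertex_holds_iff _).2 ⟨v, rfl⟩, (N.isMainNode_holds_iff _).2 ⟨x, rfl⟩⟩
    · exact Or.inr ⟨_, _, .same x v, .marginal x y, (N.realizes_main.margin x v).2 v.2⟩
  parent_typed := by
    intro a b h
    rcases (N.holds_parent_iff _ _).1 h with ⟨x, y, rfl, rfl, -⟩ | ⟨x, y, z, rfl, rfl, -⟩
    · exact Or.inl ⟨(N.isMainNode_holds_iff _).2 ⟨x, rfl⟩, (N.isMainNode_holds_iff _).2 ⟨y, rfl⟩⟩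
    · exact Or.inr ⟨_, .marginal x y, .marginal x z⟩
  marginal_typed := by
    intro a b h
    obtain ⟨x, y, rfl, rfl⟩ := (N.holds_marginal_iff _ _).1 h
    exact (N.isMainNode_holds_iff _).2 ⟨x, rfl⟩
  marginal_unique := by
    intro a b c hb hc
    obtain ⟨x, y, rfl, rfl⟩ := (N.holds_marginal_iff _ _).1 hb
    obtain ⟨_, _, ⟨⟩, rfl⟩ := (N.holds_marginal_iff _ _).1 hc
    rfl
  same_typed := by
    intro a b h
    obtain ⟨x, v, rfl, rfl⟩ := (N.holds_same_iff _ _).1 h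
    exact (N.isMainVertex_holds_iff _).2 ⟨v, rfl⟩
  same_exists := by
    intro a h
    obtain ⟨v, rfl⟩ := (N.isMainVertex_holds_iff _).1 h
    exact ⟨_, .same (N.main.top v) ⟨v, N.main.mem_margin_top v⟩⟩
  same_unique := by
    intro a b c hb hc
    obtain ⟨x, ⟨v, hv⟩, rfl, rfl⟩ := (N.holds_same_iff _ _).1 hb
    obtain ⟨x', ⟨v', hv'⟩, h, rfl⟩ := (N.holds_same_iff _ _).1 hc
    obtain rfl : v = v' := by injection h with h; injection h
    obtain rfl : x = x' := (N.main.mem_margin_iff.1 hv).symm.trans (N.main.mem_margin_iff.1 hv')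
    rfl
  same_injective := by
    intro a b c ha hb
    obtain ⟨x, v, rfl, rfl⟩ := (N.holds_same_iff _ _).1 ha
    obtain ⟨_, _, rfl, ⟨⟩⟩ := (N.holds_same_iff _ _).1 hb
    rfl
  edge_ends := by
    intro a b h
    rcases (N.holds_incident_iff _ _).1 h with ⟨v, e, rfl, rfl, hv⟩ | ⟨x, v, e, rfl, rfl, hv⟩
    · obtain ⟨w, he, hvw⟩ := exists_eq_mk_of_mem_edgeSet e hv
      refine ⟨.main (.vertex w), ?_, ?_, ?_, Or.inl ⟨?_, ?_⟩⟩
      · intro h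
        cases h
        exact hvw.ne rfl
      · exact (N.holds_incident_iff _ _).2
          (Or.inl ⟨w, e, rfl, rfl, he ▸ Sym2.mem_mk_right v w⟩)
      · intro z hz
        rcases (N.holds_incident_iff _ _).1 hz with ⟨z', _, rfl, ⟨⟩, hz'⟩ | ⟨_, _, _, -, ⟨⟩, -⟩
        rw [he, Sym2.mem_iff] at hz'
        rcases hz' with rfl | rfl
        · exact Or.inl rfl
        · exact Or.inr rfl
      · exact (N.isMainVertex_holds_iff _).2 ⟨v, rfl⟩
      · exact (N.isMainVertex_holds_iff _).2 ⟨w, rfl⟩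
    · obtain ⟨w, he, hvw⟩ := exists_eq_mk_of_mem_edgeSet e hv
      refine ⟨.marginal x (.vertex w), ?_, ?_, ?_, Or.inr ⟨_, _, .main (.node x), .same x v,
        .same x w, (relMarginal_adj_iff N.realizes_main x v w).2 hvw⟩⟩
      · intro h
        cases h
        exact hvw.ne rfl
      · exact (N.holds_incident_iff _ _).2
          (Or.inr ⟨x, w, e, rfl, rfl, he ▸ Sym2.mem_mk_right v w⟩)
      · intro z hz
        rcases (N.holds_incident_iff _ _).1 hz with ⟨_, _, -, ⟨⟩, -⟩ | ⟨_, z', _, rfl, ⟨⟩, hz'⟩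
        rw [he, Sym2.mem_iff] at hz'
        rcases hz' with rfl | rfl
        · exact Or.inl rfl
        · exact Or.inr rfl
  edge_exists := by
    intro a b b' c c' hadj hbc hbc'
    obtain ⟨x, rfl⟩ := (N.isMainNode_holds_iff a).1 hadj.1.1.1.1.2
    obtain ⟨u, rfl⟩ := (relMarginal_vertex_iff N.realizes_main x b).1 hadj.1.1
    obtain ⟨u', rfl⟩ := (relMarginal_vertex_iff N.realizes_main x b').1 hadj.1.2
    have huu' := (relMarginal_adj_iff N.realizes_main x u u').1 hadj
    have copy_eq : ∀ (u : N.main.margin x) (c : N.Elem), N.Holds .same (.main (.vertex u)) c →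
        c = .marginal x (.vertex u) := by
      intro u c huc
      obtain ⟨y, ⟨v, hv⟩, h, rfl⟩ := (N.holds_same_iff _ _).1 huc
      obtain ⟨u, hu⟩ := u
      obtain rfl : u = v := by injection h with h; injection h
      obtain rfl : y = x := (N.main.mem_margin_iff.1 hv).symm.trans (N.main.mem_margin_iff.1 hu)
      rfl
    rw [copy_eq u c hbc, copy_eq u' c' hbc']
    exact ⟨.marginal x (.edge ⟨s(u, u'), huu'⟩),
      (N.holds_incident_iff _ _).2 (Or.inr ⟨x, u, _, rfl, rfl, Sym2.mem_mk_left _ _⟩),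
      (N.holds_incident_iff _ _).2 (Or.inr ⟨x, u', _, rfl, rfl, Sym2.mem_mk_right _ _⟩)⟩
  edge_unique := by
    intro a b c d hab hac hbc had hbd
    rcases (N.holds_incident_iff _ _).1 hac with ⟨v, e, rfl, rfl, hv⟩ | ⟨x, v, e, rfl, rfl, hv⟩
    · rcases (N.holds_incident_iff _ _).1 hbc with ⟨w, _, rfl, ⟨⟩, hw⟩ | ⟨_, _, _, -, ⟨⟩, -⟩
      rcases (N.holds_incident_iff _ _).1 had with ⟨_, e', ⟨⟩, rfl, hv'⟩ | ⟨_, _, _, ⟨⟩, -, -⟩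
      rcases (N.holds_incident_iff _ _).1 hbd with ⟨_, _, ⟨⟩, ⟨⟩, hw'⟩ | ⟨_, _, _, ⟨⟩, -, -⟩
      have hvw : v ≠ w := fun h => hab (by rw [h])
      rw [Subtype.ext (((Sym2.mem_and_mem_iff hvw).1 ⟨hv, hw⟩).trans
        ((Sym2.mem_and_mem_iff hvw).1 ⟨hv', hw'⟩).symm)]
    · rcases (N.holds_incident_iff _ _).1 hbc with ⟨_, _, -, ⟨⟩, -⟩ | ⟨_, w, _, rfl, ⟨⟩, hw⟩
      rcases (N.holds_incident_iff _ _).1 had with ⟨_, _, ⟨⟩, -, -⟩ | ⟨_, _, e', ⟨⟩, rfl, hv'⟩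
      rcases (N.holds_incident_iff _ _).1 hbd with ⟨_, _, ⟨⟩, -, -⟩ | ⟨_, _, _, ⟨⟩, ⟨⟩, hw'⟩
      have hvw : v ≠ w := fun h => hab (by rw [h])
      rw [Subtype.ext (((Sym2.mem_and_mem_iff hvw).1 ⟨hv, hw⟩).trans
        ((Sym2.mem_and_mem_iff hvw).1 ⟨hv', hw'⟩).symm)]

end NestedTreeDecomposition

/-! ### Structures satisfying the axioms are encodings -/

namespace NestedTreeDecomposition

variable {U : Type} {P : RelName → U → U → Prop}

theorem IsEncoding.incident_iff (h : IsEncoding P) {u v e : U} (huv : u ≠ v)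
    (hu : P .incident u e) (hv : P .incident v e) (z : U) : P .incident z e ↔ z = u ∨ z = v := by
  obtain ⟨w, -, -, hall, -⟩ := h.edge_ends u e hu
  obtain rfl : v = w := (hall v hv).resolve_left huv.symm
  refine ⟨hall z, ?_⟩
  rintro (rfl | rfl)
  exacts [hu, hv]

/-- The elements representing the edges of a graph whose vertices are named by `ι`. -/
theorem IsEncoding.exists_edge_map (h : IsEncoding P) {W : Type} {H : SimpleGraph W} {ι : W → U}
    (hι : Function.Injective ι)
    (hH : ∀ u v, H.Adj u v → ∃ e, P .incident (ι u) e ∧ P .incident (ι v) e) :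
    ∃ ε : H.edgeSet → U, ∀ e z, P .incident z (ε e) ↔ ∃ u ∈ (e : Sym2 W), ι u = z := by
  have edge : ∀ e : H.edgeSet, ∃ a, ∀ z, P .incident z a ↔ ∃ u ∈ (e : Sym2 W), ι u = z := by
    rintro ⟨e, he⟩
    induction e with
    | _ u v =>
      obtain ⟨a, hu, hv⟩ := hH u v he
      refine ⟨a, fun z => ?_⟩
      rw [h.incident_iff (fun e => (H.ne_of_adj he) (hι e)) hu hv]
      simp [eq_comm]
  exact Classical.skolem.1 edge

theorem edge_map_injective {W : Type} {H : SimpleGraph W} {ι : W → U} (hι : Function.Injective ι)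
    {ε : H.edgeSet → U} (hε : ∀ e z, P .incident z (ε e) ↔ ∃ u ∈ (e : Sym2 W), ι u = z) :
    Function.Injective ε := by
  intro e e' hee
  refine Subtype.ext (Sym2.ext fun u => ?_)
  have mem_iff : ∀ e : H.edgeSet, u ∈ (e : Sym2 W) ↔ P .incident (ι u) (ε e) := by
    intro e
    rw [hε]
    exact ⟨fun hu => ⟨u, hu, rfl⟩, fun ⟨v, hv, hvu⟩ => hι hvu ▸ hv⟩
  rw [mem_iff, mem_iff, hee]

theorem IsEncoding.edge_map_eq (h : IsEncoding P) {W : Type} {H : SimpleGraph W} {ι : W → U}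
    (hι : Function.Injective ι) {ε : H.edgeSet → U}
    (hε : ∀ e z, P .incident z (ε e) ↔ ∃ u ∈ (e : Sym2 W), ι u = z) {u v : W} (huv : H.Adj u v)
    {a : U} (hu : P .incident (ι u) a) (hv : P .incident (ι v) a) : ε ⟨s(u, v), huv⟩ = a :=
  h.edge_unique (ι u) (ι v) _ _ (fun e => huv.ne (hι e))
    ((hε _ _).2 ⟨u, Sym2.mem_mk_left u v, rfl⟩) ((hε _ _).2 ⟨v, Sym2.mem_mk_right u v, rfl⟩) hu hv

/-- The sorts of the elements of an encoding: vertices, nodes and edges, of the main decomposition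
and of the marginal decompositions. -/
inductive ElemSort : Type
  | mainVertex
  | mainNode
  | mainEdge
  | marginalVertex
  | marginalNode
  | marginalEdge

variable (P) in
/-- The elements of each sort. -/
def HasSort : ElemSort → U → Prop
  | .mainVertex, v => IsMainVertex P v
  | .mainNode, x => IsMainNode P x
  | .mainEdge, e => ∃ v, IsMainVertex P v ∧ P .incident v e
  | .marginalVertex, v => ∃ u, P .same u v
  | .marginalNode, y => ∃ x, P .marginal y x
  | .marginalEdge, e => ∃ u v, P .same u v ∧ P .incident v e

theorem IsEncoding.sort_unique (h : IsEncoding P) {i j : ElemSort} {a : U} (hi : HasSort P i a)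
    (hj : HasSort P j a) : i = j := by
  have edges : HasSort P .mainEdge a → ¬ HasSort P .marginalEdge a := by
    rintro ⟨v, hv, hva⟩ ⟨u, v', huv', hv'a⟩
    obtain ⟨w, -, -, hall, ⟨hv', -⟩ | ⟨_, u', _, hs, hs', -⟩⟩ := h.edge_ends v' a hv'a
    · exact hv'.2 ⟨u, huv'⟩
    · rcases hall v hva with rfl | rfl
      · exact hv.2 ⟨u, huv'⟩
      · exact hv.2 ⟨u', hs'⟩
  have vertex_main : HasSort P .mainVertex a → ∃ x, P .bag a x := fun h => h.1
  have vertex_marginal : HasSort P .marginalVertex a → ∃ x, P .bag a x := fun ⟨u, hu⟩ =>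
    h.vertex_of_same u a hu
  have node_main : HasSort P .mainNode a → ∃ v, P .bag v a := fun h => h.1
  have node_marginal : HasSort P .marginalNode a → ∃ v, P .bag v a := fun ⟨x, hx⟩ =>
    h.node_of_marginal a x hx
  have edge_main : HasSort P .mainEdge a → ∃ v, P .incident v a := fun ⟨v, _, h⟩ => ⟨v, h⟩
  have edge_marginal : HasSort P .marginalEdge a → ∃ v, P .incident v a := fun ⟨_, v, _, h⟩ =>
    ⟨v, h⟩
  have vertices : HasSort P .mainVertex a → ¬ HasSort P .marginalVertex a := fun h => h.2
  have nodes : HasSort P .mainNode a → ¬ HasSort P .marginalNode a := fun h => h.2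
  have hVN := h.vertex_or_node a
  have hVE := h.vertex_or_edge a
  have hNE := h.node_or_edge a
  generalize (∃ x, P .bag a x) = isVertex at *
  generalize (∃ v, P .bag v a) = isNode at *
  generalize (∃ v, P .incident v a) = isEdge at *
  generalize HasSort P = sort at *
  cases i <;> cases j <;> first | rfl | (exfalso; grind)

/-- The sort of an element of the encoding of a nested tree decomposition. -/
def Elem.sort {V : Type} {G : SimpleGraph V} {N : NestedTreeDecomposition G} : N.Elem → ElemSort
  | .main (.vertex _) => .mainVertex
  | .main (.node _) => .mainNode
  | .main (.edge _) => .mainEdge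
  | .marginal _ (.vertex _) => .marginalVertex
  | .marginal _ (.node _) => .marginalNode
  | .marginal _ (.edge _) => .marginalEdge

/-- Names in `U` for all elements of the encoding of a nested tree decomposition `N`, compatible
with the relations `P` on `U`: the vertices, nodes and edges of the main decomposition are named by
`ι`, `ν` and `ε`, and those of the marginal decompositions by `κ`, `νm` and `εm`. One function `κ`
names all copies of vertices, since every vertex lies in exactly one margin. -/
structure Naming {V : Type} {G : SimpleGraph V} (N : NestedTreeDecomposition G)
    (P : RelName → U → U → Prop) where
  ι : V → U
  ν : N.main.Node → U
  ε : G.edgeSet → U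
  κ : V → U
  νm : ∀ x, (N.marginal x).Node → U
  εm : ∀ x, (N.main.marginalGraph x).edgeSet → U
  main : (relMain P).Realizes N.main ι ν
  marginal : ∀ x, (relMarginal P (ν x)).Realizes (N.marginal x) (fun v => ι v) (νm x)
  same : ∀ v, P .same (ι v) (κ v)
  edge : ∀ e z, P .incident z (ε e) ↔ ∃ u ∈ (e : Sym2 V), ι u = z
  marginal_edge : ∀ x e z, P .incident z (εm x e) ↔ ∃ u ∈ (e : Sym2 (N.main.margin x)), κ u = z

namespace Naming

variable {V : Type} {G : SimpleGraph V} {N : NestedTreeDecomposition G} (f : Naming N P)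

/-- The name of an element. -/
def toFun : N.Elem → U
  | .main (.vertex v) => f.ι v
  | .main (.node x) => f.ν x
  | .main (.edge e) => f.ε e
  | .marginal _ (.vertex v) => f.κ v
  | .marginal x (.node y) => f.νm x y
  | .marginal x (.edge e) => f.εm x e

theorem isMainVertex (v : V) : IsMainVertex P (f.ι v) := (f.main.vertex _).2 ⟨v, rfl⟩

theorem isMainNode (x : N.main.Node) : IsMainNode P (f.ν x) := (f.main.node _).2 ⟨x, rfl⟩

theorem marginal_node (x : N.main.Node) (y : (N.marginal x).Node) :
    P .marginal (f.νm x y) (f.ν x) := ((f.marginal x).node _).2 ⟨y, rfl⟩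

theorem hasSort (a : N.Elem) : HasSort P a.sort (f.toFun a) := by
  rcases a with (v | e | x) | ⟨x, v | e | y⟩
  · exact f.isMainVertex v
  · exact ⟨_, f.isMainVertex _, (f.edge e _).2 ⟨_, Sym2.out_fst_mem _, rfl⟩⟩
  · exact f.isMainNode x
  · exact ⟨_, f.same v⟩
  · exact ⟨_, _, f.same _, (f.marginal_edge x e _).2 ⟨_, Sym2.out_fst_mem _, rfl⟩⟩
  · exact ⟨_, f.marginal_node x y⟩

theorem κ_injective (h : IsEncoding P) : Function.Injective f.κ := fun v w hvw =>
  f.main.vertex_injective (h.same_injective _ _ _ (f.same v) (hvw ▸ f.same w))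

theorem eq_of_mem_margin {x x' : N.main.Node} {v : V} (hx : v ∈ N.main.margin x)
    (hx' : v ∈ N.main.margin x') : x = x' :=
  (N.main.mem_margin_iff.1 hx).symm.trans (N.main.mem_margin_iff.1 hx')

theorem toFun_injective (h : IsEncoding P) : Function.Injective f.toFun := by
  intro a b hab
  have hsort : a.sort = b.sort := h.sort_unique (f.hasSort a) (hab ▸ f.hasSort b)
  rcases a with (v | e | x) | ⟨x, v | e | y⟩ <;>
    rcases b with (v' | e' | x') | ⟨x', v' | e' | y'⟩ <;> cases hsort
  · rw [f.main.vertex_injective hab]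
  · rw [edge_map_injective f.main.vertex_injective f.edge hab]
  · rw [f.main.node_injective hab]
  · obtain ⟨v, hv⟩ := v
    obtain ⟨v', hv'⟩ := v'
    obtain rfl : v = v' := f.κ_injective h hab
    obtain rfl := eq_of_mem_margin hv hv'
    rfl
  · -- The two edges have the same end, which determines the node of the main decomposition.
    obtain ⟨u, -, hu⟩ := (f.marginal_edge x' e' _).1
      ((iff_of_eq (congrArg (P .incident _) hab)).1
        ((f.marginal_edge x e _).2 ⟨_, Sym2.out_fst_mem _, rfl⟩))
    obtain rfl := eq_of_mem_margin (f.κ_injective h hu ▸ u.2) (Subtype.property _)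
    rw [edge_map_injective ((f.κ_injective h).comp Subtype.val_injective) (f.marginal_edge x') hab]
  · have hy' : P .marginal (f.νm x y) (f.ν x') := by
      rw [show f.νm x y = f.νm x' y' from hab]
      exact f.marginal_node x' y'
    obtain rfl := f.main.node_injective (h.marginal_unique _ _ _ (f.marginal_node x y) hy')
    rw [(f.marginal x).node_injective hab]

theorem toFun_surjective (h : IsEncoding P) : Function.Surjective f.toFun := by
  intro a
  rcases h.exhaustive a with ha | ha | ⟨v, hv⟩
  · by_cases hs : ∃ u, P .same u a
    · obtain ⟨u, hu⟩ := hs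
      obtain ⟨v, rfl⟩ := (f.main.vertex u).1 (h.same_typed _ _ hu)
      exact ⟨.marginal (N.main.top v) (.vertex ⟨v, N.main.mem_margin_top v⟩),
        h.same_unique _ _ _ (f.same v) hu⟩
    · obtain ⟨v, rfl⟩ := (f.main.vertex a).1 ⟨ha, hs⟩
      exact ⟨.main (.vertex v), rfl⟩
  · by_cases hm : ∃ x, P .marginal a x
    · obtain ⟨b, hb⟩ := hm
      obtain ⟨x, rfl⟩ := (f.main.node b).1 (h.marginal_typed _ _ hb)
      obtain ⟨y, rfl⟩ := ((f.marginal x).node a).1 hb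
      exact ⟨.marginal x (.node y), rfl⟩
    · obtain ⟨x, rfl⟩ := (f.main.node a).1 ⟨ha, hm⟩
      exact ⟨.main (.node x), rfl⟩
  · obtain ⟨w, hvw, hw, -, ⟨hv', hw'⟩ | ⟨b, b', c, hb, hb', hadj⟩⟩ := h.edge_ends v a hv
    · obtain ⟨v, rfl⟩ := (f.main.vertex _).1 hv'
      obtain ⟨w, rfl⟩ := (f.main.vertex _).1 hw'
      have huv : G.Adj v w := (f.main.adj v w).1 ⟨⟨hv', hw'⟩, hvw, a, hv, hw⟩
      exact ⟨.main (.edge ⟨s(v, w), huv⟩), h.edge_map_eq f.main.vertex_injective f.edge huv hv hw⟩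
    · obtain ⟨x, rfl⟩ := (f.main.node c).1 hadj.1.1.1.1.2
      obtain ⟨u, rfl⟩ := ((f.marginal x).vertex b).1 hadj.1.1
      obtain ⟨u', rfl⟩ := ((f.marginal x).vertex b').1 hadj.1.2
      have huu' := ((f.marginal x).adj u u').1 hadj
      rw [h.same_unique _ _ _ hb (f.same u)] at hv
      rw [h.same_unique _ _ _ hb' (f.same u')] at hw
      exact ⟨.marginal x (.edge ⟨s(u, u'), huu'⟩), h.edge_map_eq
        ((f.κ_injective h).comp Subtype.val_injective) (f.marginal_edge x) huu' hv hw⟩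

/-- The typing axioms determine the sorts of related elements, and uniqueness of sorts tells which
elements of the encoding are named. -/
theorem holds_of_toFun (h : IsEncoding P) {r : RelName} {a b : N.Elem}
    (hab : P r (f.toFun a) (f.toFun b)) : N.Holds r a b := by
  have sort_eq : ∀ {a : N.Elem} {i}, HasSort P i (f.toFun a) → a.sort = i := fun h' =>
    h.sort_unique (f.hasSort _) h'
  cases r with
  | incident =>
    obtain ⟨w, -, -, -, ⟨hv, -⟩ | ⟨u, _, _, hu, -⟩⟩ := h.edge_ends _ _ hab
    · have ha := sort_eq (i := .mainVertex) hv
      have hb := sort_eq (i := .mainEdge) ⟨_, hv, hab⟩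
      rcases a with (v | e | x) | ⟨x, v | e | y⟩ <;> cases ha
      rcases b with (v' | e | x) | ⟨x, v' | e | y⟩ <;> cases hb
      obtain ⟨u, hu, huv⟩ := (f.edge e _).1 hab
      exact (N.holds_incident_iff _ _).2
        (Or.inl ⟨v, e, rfl, rfl, f.main.vertex_injective huv ▸ hu⟩)
    · have ha := sort_eq (i := .marginalVertex) ⟨u, hu⟩
      have hb := sort_eq (i := .marginalEdge) ⟨u, _, hu, hab⟩
      rcases a with (v | e | x) | ⟨x, v | e | y⟩ <;> cases ha
      rcases b with (v' | e | x') | ⟨x', v' | e | y⟩ <;> cases hb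
      obtain ⟨u', hu', huv⟩ := (f.marginal_edge x' e _).1 hab
      have huv' : (u' : V) = v := f.κ_injective h huv
      obtain rfl := eq_of_mem_margin v.2 (huv' ▸ u'.2)
      exact (N.holds_incident_iff _ _).2
        (Or.inr ⟨x, v, e, rfl, rfl, Subtype.ext huv' ▸ hu'⟩)
  | bag =>
    rcases h.bag_typed _ _ hab with ⟨hv, hx⟩ | ⟨u, c, hu, hc, huc⟩
    · have ha := sort_eq (i := .mainVertex) hv
      have hb := sort_eq (i := .mainNode) hx
      rcases a with (v | e | x) | ⟨x, v | e | y⟩ <;> cases ha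
      rcases b with (v' | e | x) | ⟨x, v' | e | y⟩ <;> cases hb
      exact (N.holds_bag_iff _ _).2
        (Or.inl ⟨v, x, rfl, rfl, (f.main.bag v x).1 ⟨⟨hv, hx⟩, hab⟩⟩)
    · have ha := sort_eq (i := .marginalVertex) ⟨u, hu⟩
      have hb := sort_eq (i := .marginalNode) ⟨c, hc⟩
      rcases a with (v | e | x) | ⟨x, v | e | y⟩ <;> cases ha
      rcases b with (v' | e | x') | ⟨x', v' | e | y⟩ <;> cases hb
      obtain rfl := h.marginal_unique _ _ _ hc (f.marginal_node x' y)
      obtain rfl := h.same_injective _ _ _ hu (f.same v)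
      obtain rfl := eq_of_mem_margin v.2 ((f.main.margin x' v).1 huc)
      exact (N.holds_bag_iff _ _).2 (Or.inr ⟨x, v, y, rfl, rfl,
        ((f.marginal x).bag v y).1 ⟨⟨huc, hc⟩, _, hu, hab⟩⟩)
  | parent =>
    rcases h.parent_typed _ _ hab with ⟨hx, hy⟩ | ⟨c, hx, hy⟩
    · have ha := sort_eq (i := .mainNode) hx
      have hb := sort_eq (i := .mainNode) hy
      rcases a with (v | e | x) | ⟨x, v | e | y⟩ <;> cases ha
      rcases b with (v' | e | y) | ⟨x', v' | e | y⟩ <;> cases hb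
      exact (N.holds_parent_iff _ _).2
        (Or.inl ⟨x, y, rfl, rfl, (f.main.parent x y).1 ⟨⟨hx, hy⟩, hab⟩⟩)
    · have ha := sort_eq (i := .marginalNode) ⟨c, hx⟩
      have hb := sort_eq (i := .marginalNode) ⟨c, hy⟩
      rcases a with (v | e | x) | ⟨x, v | e | y⟩ <;> cases ha
      rcases b with (v' | e | x') | ⟨x', v' | e | z⟩ <;> cases hb
      obtain rfl := h.marginal_unique _ _ _ hx (f.marginal_node x y)
      obtain rfl := f.main.node_injective (h.marginal_unique _ _ _ hy (f.marginal_node x' z))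
      exact (N.holds_parent_iff _ _).2 (Or.inr ⟨x, y, z, rfl, rfl,
        ((f.marginal x).parent y z).1 ⟨⟨hx, hy⟩, hab⟩⟩)
  | same =>
    have ha := sort_eq (i := .mainVertex) (h.same_typed _ _ hab)
    have hb := sort_eq (i := .marginalVertex) ⟨_, hab⟩
    rcases a with (v | e | x) | ⟨x, v | e | y⟩ <;> cases ha
    rcases b with (v' | e | x) | ⟨x, v' | e | y⟩ <;> cases hb
    obtain rfl := f.main.vertex_injective (h.same_injective _ _ _ hab (f.same v'))
    exact .same x v'
  | marginal =>
    have ha := sort_eq (i := .marginalNode) ⟨_, hab⟩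
    have hb := sort_eq (i := .mainNode) (h.marginal_typed _ _ hab)
    rcases a with (v | e | x) | ⟨x, v | e | y⟩ <;> cases ha
    rcases b with (v' | e | x') | ⟨x', v' | e | z⟩ <;> cases hb
    obtain rfl := f.main.node_injective (h.marginal_unique _ _ _ hab (f.marginal_node x y))
    exact .marginal _ y

theorem toFun_of_holds (h : IsEncoding P) {r : RelName} {a b : N.Elem} (hab : N.Holds r a b) :
    P r (f.toFun a) (f.toFun b) := by
  have copy_bag : ∀ x v y, v ∈ (N.marginal x).bag y → P .bag (f.κ v) (f.νm x y) := by
    intro x v y hv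
    obtain ⟨-, v', hs, hv'⟩ := ((f.marginal x).bag v y).2 hv
    rwa [h.same_unique _ _ _ (f.same v) hs]
  cases hab with
  | ofMain R a b h =>
    cases h with
    | incident v e h => exact (f.edge e _).2 ⟨v, h, rfl⟩
    | bag v x h => exact ((f.main.bag v x).2 h).2
    | parent x y h => exact ((f.main.parent x y).2 h).2
  | ofMarginal R x a b h =>
    cases h with
    | incident v e h => exact (f.marginal_edge x e _).2 ⟨v, h, rfl⟩
    | bag v y h => exact copy_bag x v y h
    | parent y z h => exact (((f.marginal x).parent y z).2 h).2
  | same x v => exact f.same v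
  | marginal x y => exact f.marginal_node x y

end Naming

/-- The sanity axioms give the decompositions, and the axioms on `same` and `incident` give the
names of the copies and of the edges. -/
theorem IsEncoding.exists_naming [Finite U] (h : IsEncoding P) :
    ∃ (V : Type) (_ : Finite V) (G : SimpleGraph V) (N : NestedTreeDecomposition G),
      Nonempty (Naming N P) := by
  let V := {v // IsMainVertex P v}
  let G : SimpleGraph V :=
    { Adj := fun u v => (relMain P).adj u v
      symm := ⟨fun _ _ ⟨⟨hu, hv⟩, hne, e, he, he'⟩ =>
        ⟨⟨hv, hu⟩, fun e => hne e.symm, e, he', he⟩⟩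
      loopless := ⟨fun _ h => h.2.1 rfl⟩ }
  let ι : V → U := Subtype.val
  have hι : Function.Injective ι := Subtype.val_injective
  obtain ⟨t, ν, hmain, ht⟩ := h.main_sane.exists_realizes (G := G) hι
    (fun a => ⟨fun ha => ⟨⟨a, ha⟩, rfl⟩, fun ⟨v, hv⟩ => hv ▸ v.2⟩) (fun _ _ => Iff.rfl)
  have marg : ∀ x, ∃ (s : TreeDecomposition (t.marginalGraph x)) (μ : s.Node → U),
      (relMarginal P (ν x)).Realizes s (fun v => ι v) μ ∧ s.Sane := fun x =>
    (h.marginal_sane _ ((hmain.node _).2 ⟨x, rfl⟩)).exists_realizes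
      (hι.comp Subtype.val_injective) (relMarginal_vertex_iff hmain x) (relMarginal_adj_iff hmain x)
  choose s μ hs hsane using marg
  choose κ hκ using fun v : V => h.same_exists v v.2
  have hκ_inj : Function.Injective κ := fun v w hvw =>
    hι (h.same_injective _ _ _ (hκ v) (hvw ▸ hκ w))
  obtain ⟨ε, hε⟩ := h.exists_edge_map (H := G) hι fun u v huv => huv.2.2
  have edge := fun x => h.exists_edge_map (H := t.marginalGraph x)
    (hκ_inj.comp Subtype.val_injective) fun u v huv =>
      h.edge_exists _ _ _ _ _ ((relMarginal_adj_iff hmain x u v).2 huv) (hκ u) (hκ v)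
  choose εm hεm using edge
  exact ⟨V, inferInstance, G, ⟨t, ht, s, hsane⟩, ⟨⟨ι, ν, ε, κ, μ, εm, hmain, hs, hκ, hε, hεm⟩⟩⟩

/-- A structure satisfying the axioms is isomorphic to the encoding of a nested tree
decomposition. -/
theorem IsEncoding.exists_equiv [Finite U] (h : IsEncoding P) :
    ∃ (V : Type) (_ : Finite V) (G : SimpleGraph V) (N : NestedTreeDecomposition G)
      (e : N.Elem ≃ U), ∀ r a b, N.Holds r a b ↔ P r (e a) (e b) := by
  obtain ⟨V, hV, G, N, ⟨f⟩⟩ := h.exists_naming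
  exact ⟨V, hV, G, N, Equiv.ofBijective f.toFun ⟨f.toFun_injective h, f.toFun_surjective h⟩,
    fun r a b => ⟨f.toFun_of_holds h, f.holds_of_toFun h⟩⟩

end NestedTreeDecomposition

/-! ### The axioms are definable -/

namespace NestedTreeDecomposition

open MSO RelDecomp

section Definability

variable {n m : ℕ}

theorem definable_isMainVertex (i : Fin n) : Definable (S := Vocabulary.binary RelName) (m := m)
    fun A v _ => IsMainVertex A.holds (v i) :=
  (Definable.ex (.holds _ _ _)).and (.not (.ex (.holds _ _ _)))

theorem definable_isMainNode (i : Fin n) : Definable (S := Vocabulary.binary RelName) (m := m)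
    fun A v _ => IsMainNode A.holds (v i) :=
  (Definable.ex (.holds _ _ _)).and (.not (.ex (.holds _ _ _)))

theorem definableFamily_relMain : DefinableFamily (S := Vocabulary.binary RelName) (p := 0)
    fun A _ => relMain A.holds where
  vertex _ i := definable_isMainVertex i
  node _ i := definable_isMainNode i
  adj _ _ _ := .and (.and (definable_isMainVertex _) (definable_isMainVertex _))
    (.and (.not (.eq _ _)) (.ex (.and (.holds _ _ _) (.holds _ _ _))))
  bag _ _ _ := .and (.and (definable_isMainVertex _) (definable_isMainNode _)) (.holds _ _ _)
  parent _ _ _ := .and (.and (definable_isMainNode _) (definable_isMainNode _)) (.holds _ _ _)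

theorem definable_margin (i j : Fin n) : Definable (S := Vocabulary.binary RelName) (m := m)
    fun A v _ => (relMain A.holds).margin (v i) (v j) :=
  definableFamily_relMain.margin Fin.elim0 i j

theorem definable_adhesion (i j : Fin n) : Definable (S := Vocabulary.binary RelName) (m := m)
    fun A v _ => (relMain A.holds).adhesion (v i) (v j) :=
  definableFamily_relMain.adhesion Fin.elim0 i j

theorem definableFamily_relMarginal : DefinableFamily (S := Vocabulary.binary RelName) (p := 1)
    fun A ρ => relMarginal A.holds (ρ 0) where
  vertex _ _ := definable_margin _ _
  node _ _ := .holds _ _ _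
  adj _ _ _ := .and (.and (definable_margin _ _) (definable_margin _ _)) (.and (.not (.eq _ _))
    (.or (definableFamily_relMain.adj Fin.elim0 _ _)
      (.ex (.and (definableFamily_relMain.parent Fin.elim0 _ _)
        (.and (definable_adhesion _ _) (definable_adhesion _ _))))))
  bag _ _ _ := .and (.and (definable_margin _ _) (.holds _ _ _))
    (.ex (.and (.holds _ _ _) (.holds _ _ _)))
  parent _ _ _ := .and (.and (.holds _ _ _) (.holds _ _ _)) (.holds _ _ _)

theorem definable_isEncoding : Definable (S := Vocabulary.binary RelName) (n := n) (m := m)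
    fun A _ _ => IsEncoding A.holds := by
  have adj : ∀ {n m : ℕ} (k i j : Fin n), Definable (S := Vocabulary.binary RelName) (m := m)
      fun A v _ => (relMarginal A.holds (v k)).adj (v i) (v j) := fun k i j =>
    definableFamily_relMarginal.adj (fun _ => k) i j
  have main_sane : Definable (S := Vocabulary.binary RelName) (n := n) (m := m)
      fun A _ _ => (relMain A.holds).IsSane := definableFamily_relMain.isSane Fin.elim0
  have marginal_sane : Definable (S := Vocabulary.binary RelName) (n := n) (m := m)
      fun A _ _ => ∀ x, IsMainNode A.holds x → (relMarginal A.holds x).IsSane :=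
    .all (.imp (definable_isMainNode _) (definableFamily_relMarginal.isSane fun _ => 0))
  have exhaustive : Definable (S := Vocabulary.binary RelName) (n := n) (m := m)
      fun A _ _ => ∀ a, (∃ x, A.holds .bag a x) ∨ (∃ v, A.holds .bag v a) ∨
        ∃ v, A.holds .incident v a :=
    .all (.or (.ex (.holds _ _ _)) (.or (.ex (.holds _ _ _)) (.ex (.holds _ _ _))))
  have vertex_or_node : Definable (S := Vocabulary.binary RelName) (n := n) (m := m)
      fun A _ _ => ∀ a, (∃ x, A.holds .bag a x) → ¬ ∃ v, A.holds .bag v a :=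
    .all (.imp (.ex (.holds _ _ _)) (.not (.ex (.holds _ _ _))))
  have vertex_or_edge : Definable (S := Vocabulary.binary RelName) (n := n) (m := m)
      fun A _ _ => ∀ a, (∃ x, A.holds .bag a x) → ¬ ∃ v, A.holds .incident v a :=
    .all (.imp (.ex (.holds _ _ _)) (.not (.ex (.holds _ _ _))))
  have node_or_edge : Definable (S := Vocabulary.binary RelName) (n := n) (m := m)
      fun A _ _ => ∀ a, (∃ v, A.holds .bag v a) → ¬ ∃ v, A.holds .incident v a :=
    .all (.imp (.ex (.holds _ _ _)) (.not (.ex (.holds _ _ _))))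
  have vertex_of_same : Definable (S := Vocabulary.binary RelName) (n := n) (m := m)
      fun A _ _ => ∀ u v, A.holds .same u v → ∃ x, A.holds .bag v x :=
    .all (.all (.imp (.holds _ _ _) (.ex (.holds _ _ _))))
  have node_of_marginal : Definable (S := Vocabulary.binary RelName) (n := n) (m := m)
      fun A _ _ => ∀ y x, A.holds .marginal y x → ∃ v, A.holds .bag v y :=
    .all (.all (.imp (.holds _ _ _) (.ex (.holds _ _ _))))
  have bag_typed : Definable (S := Vocabulary.binary RelName) (n := n) (m := m)
      fun A _ _ => ∀ v y, A.holds .bag v y → (IsMainVertex A.holds v ∧ IsMainNode A.holds y) ∨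
        ∃ u x, A.holds .same u v ∧ A.holds .marginal y x ∧ (relMain A.holds).margin x u :=
    .all (.all (.imp (.holds _ _ _) (.or (.and (definable_isMainVertex _) (definable_isMainNode _))
      (.ex (.ex (.and (.holds _ _ _) (.and (.holds _ _ _) (definable_margin _ _))))))))
  have parent_typed : Definable (S := Vocabulary.binary RelName) (n := n) (m := m)
      fun A _ _ => ∀ x y, A.holds .parent x y → (IsMainNode A.holds x ∧ IsMainNode A.holds y) ∨
        ∃ z, A.holds .marginal x z ∧ A.holds .marginal y z :=
    .all (.all (.imp (.holds _ _ _) (.or (.and (definable_isMainNode _) (definable_isMainNode _))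
      (.ex (.and (.holds _ _ _) (.holds _ _ _))))))
  have marginal_typed : Definable (S := Vocabulary.binary RelName) (n := n) (m := m)
      fun A _ _ => ∀ y x, A.holds .marginal y x → IsMainNode A.holds x :=
    .all (.all (.imp (.holds _ _ _) (definable_isMainNode _)))
  have marginal_unique : Definable (S := Vocabulary.binary RelName) (n := n) (m := m)
      fun A _ _ => ∀ y x x', A.holds .marginal y x → A.holds .marginal y x' → x = x' :=
    .all (.all (.all (.imp (.holds _ _ _) (.imp (.holds _ _ _) (.eq _ _)))))
  have same_typed : Definable (S := Vocabulary.binary RelName) (n := n) (m := m)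
      fun A _ _ => ∀ u v, A.holds .same u v → IsMainVertex A.holds u :=
    .all (.all (.imp (.holds _ _ _) (definable_isMainVertex _)))
  have same_exists : Definable (S := Vocabulary.binary RelName) (n := n) (m := m)
      fun A _ _ => ∀ u, IsMainVertex A.holds u → ∃ v, A.holds .same u v :=
    .all (.imp (definable_isMainVertex _) (.ex (.holds _ _ _)))
  have same_unique : Definable (S := Vocabulary.binary RelName) (n := n) (m := m)
      fun A _ _ => ∀ u v v', A.holds .same u v → A.holds .same u v' → v = v' :=
    .all (.all (.all (.imp (.holds _ _ _) (.imp (.holds _ _ _) (.eq _ _)))))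
  have same_injective : Definable (S := Vocabulary.binary RelName) (n := n) (m := m)
      fun A _ _ => ∀ u u' v, A.holds .same u v → A.holds .same u' v → u = u' :=
    .all (.all (.all (.imp (.holds _ _ _) (.imp (.holds _ _ _) (.eq _ _)))))
  have edge_ends : Definable (S := Vocabulary.binary RelName) (n := n) (m := m)
      fun A _ _ => ∀ v e, A.holds .incident v e → ∃ w, ¬ v = w ∧ A.holds .incident w e ∧
        (∀ z, A.holds .incident z e → z = v ∨ z = w) ∧
        ((IsMainVertex A.holds v ∧ IsMainVertex A.holds w) ∨ ∃ u u' x, A.holds .same u v ∧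
          A.holds .same u' w ∧ (relMarginal A.holds x).adj u u') :=
    .all (.all (.imp (.holds _ _ _) (.ex (.and (.not (.eq _ _)) (.and (.holds _ _ _) (.and
      (.all (.imp (.holds _ _ _) (.or (.eq _ _) (.eq _ _))))
      (.or (.and (definable_isMainVertex _) (definable_isMainVertex _))
        (.ex (.ex (.ex (.and (.holds _ _ _) (.and (.holds _ _ _) (adj _ _ _)))))))))))))
  have edge_exists : Definable (S := Vocabulary.binary RelName) (n := n) (m := m)
      fun A _ _ => ∀ x u u' v v', (relMarginal A.holds x).adj u u' → A.holds .same u v →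
        A.holds .same u' v' → ∃ e, A.holds .incident v e ∧ A.holds .incident v' e :=
    .all (.all (.all (.all (.all (.imp (adj _ _ _) (.imp (.holds _ _ _) (.imp (.holds _ _ _)
      (.ex (.and (.holds _ _ _) (.holds _ _ _))))))))))
  have edge_unique : Definable (S := Vocabulary.binary RelName) (n := n) (m := m)
      fun A _ _ => ∀ v w e e', ¬ v = w → A.holds .incident v e → A.holds .incident w e →
        A.holds .incident v e' → A.holds .incident w e' → e = e' :=
    .all (.all (.all (.all (.imp (.not (.eq _ _)) (.imp (.holds _ _ _) (.imp (.holds _ _ _)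
      (.imp (.holds _ _ _) (.imp (.holds _ _ _) (.eq _ _)))))))))
  refine (main_sane.and <| marginal_sane.and <| exhaustive.and <| vertex_or_node.and <|
    vertex_or_edge.and <| node_or_edge.and <| vertex_of_same.and <| node_of_marginal.and <|
    bag_typed.and <| parent_typed.and <| marginal_typed.and <| marginal_unique.and <|
    same_typed.and <| same_exists.and <| same_unique.and <| same_injective.and <|
    edge_ends.and <| edge_exists.and edge_unique).congr fun A _ _ => ⟨?_, ?_⟩
  · rintro ⟨h₁, h₂, h₃, h₄, h₅, h₆, h₇, h₈, h₉, k₁, k₂, k₃, k₄, k₅, k₆, k₇, k₈, k₉, l₁⟩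
    exact ⟨h₁, h₂, h₃, h₄, h₅, h₆, h₇, h₈, h₉, k₁, k₂, k₃, k₄, k₅, k₆, k₇, k₈, k₉, l₁⟩
  · rintro ⟨h₁, h₂, h₃, h₄, h₅, h₆, h₇, h₈, h₉, k₁, k₂, k₃, k₄, k₅, k₆, k₇, k₈, k₉, l₁⟩
    exact ⟨h₁, h₂, h₃, h₄, h₅, h₆, h₇, h₈, h₉, k₁, k₂, k₃, k₄, k₅, k₆, k₇, k₈, k₉, l₁⟩

end Definability

/-! ### The interpretation -/

section Flat

variable {U : Type} (P : RelName → U → U → Prop)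

/-- The elements of the output: the vertices and edges of the main decomposition and the nodes of
the marginal decompositions. -/
def IsFlatElem (a : U) : Prop :=
  IsMainVertex P a ∨ (∃ v, IsMainVertex P v ∧ P .incident v a) ∨ ∃ x, P .marginal a x

/-- The bags of the flattened decomposition, in terms of the relations of the nested one. -/
def IsFlatBag (v y : U) : Prop :=
  ∃ x, P .marginal y x ∧ ((relMarginal P x).bag v y ∨ (relMain P).adhesion x v)

/-- The parent relation of the flattened decomposition, in terms of the relations of the nested one.
The second alternative says that `a` is a root of its marginal decomposition, that `b` has the whole
adhesion in its bag, and that `b` is the topmost node of some vertex `w` of the adhesion. -/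
def IsFlatParent (b a : U) : Prop :=
  ∃ x, P .marginal a x ∧ ((relMarginal P x).parent b a ∨
    ((¬ ∃ c, (relMarginal P x).parent c a) ∧
      (∀ v, (relMain P).adhesion x v → IsFlatBag P v b) ∧
      ∃ w, (relMain P).adhesion x w ∧ ∃ x', (relMarginal P x').margin b w))

/-- The relations of the output. On `IsFlatElem`, which contains no copies of vertices, `incident`
is restricted to the main decomposition. -/
def FlatHolds : TreeDecomposition.RelName → U → U → Prop
  | .incident => P .incident
  | .bag => IsFlatBag P
  | .parent => IsFlatParent P

end Flat

theorem definable_isFlatElem : Definable (S := Vocabulary.binary RelName) (n := 1) (m := 0)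
    fun A v _ => IsFlatElem A.holds (v 0) :=
  .or (definable_isMainVertex _) (.or (.ex (.and (definable_isMainVertex _) (.holds _ _ _)))
    (.ex (.holds _ _ _)))

theorem definable_isFlatBag {n m : ℕ} (i j : Fin n) :
    Definable (S := Vocabulary.binary RelName) (m := m)
      fun A v _ => IsFlatBag A.holds (v i) (v j) :=
  .ex (.and (.holds _ _ _) (.or (definableFamily_relMarginal.bag (fun _ => 0) _ _)
    (definable_adhesion _ _)))

theorem definable_isFlatParent {n m : ℕ} (i j : Fin n) :
    Definable (S := Vocabulary.binary RelName) (m := m)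
      fun A v _ => IsFlatParent A.holds (v i) (v j) :=
  .ex (.and (.holds _ _ _) (.or (definableFamily_relMarginal.parent (fun _ => 0) _ _)
    (.and (.not (.ex (definableFamily_relMarginal.parent (fun _ => Fin.succ 0) _ _)))
      (.and (.all (.imp (definable_adhesion _ _) (definable_isFlatBag _ _)))
        (.ex (.and (definable_adhesion _ _)
          (.ex (definableFamily_relMarginal.margin (fun _ => 0) _ _))))))))

theorem definable_flatHolds (r : TreeDecomposition.RelName) :
    Definable (S := Vocabulary.binary RelName) (n := 2) (m := 0)
      fun A v _ => FlatHolds A.holds r (v 0) (v 1) :=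
  match r with
  | .incident => .holds _ _ _
  | .bag => definable_isFlatBag _ _
  | .parent => definable_isFlatParent _ _

/-- The interpretation that flattens nested tree decompositions. Its formulas are chosen among those
expressing the intended properties. -/
noncomputable def flattenInterpretation : Interpretation (Vocabulary.binary RelName)
    (Vocabulary.binary TreeDecomposition.RelName) where
  dom := definable_isEncoding.choose
  univ := definable_isFlatElem.choose
  rel r := (definable_flatHolds r).choose

theorem dom_sat_iff (A : Struct (Vocabulary.binary RelName)) :
    flattenInterpretation.dom.Sat A ![] ![] ↔ IsEncoding A.holds :=
  definable_isEncoding.choose_spec A ![] ![]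

theorem univ_sat_iff (A : Struct (Vocabulary.binary RelName)) (a : A.carrier) :
    flattenInterpretation.univ.Sat A ![a] ![] ↔ IsFlatElem A.holds a :=
  definable_isFlatElem.choose_spec A ![a] ![]

theorem rel_sat_iff (A : Struct (Vocabulary.binary RelName)) (r : TreeDecomposition.RelName)
    (v : Fin 2 → A.carrier) :
    (flattenInterpretation.rel r).Sat A v ![] ↔ FlatHolds A.holds r (v 0) (v 1) :=
  (definable_flatHolds r).choose_spec A v ![]

variable {V : Type} {G : SimpleGraph V} (N : NestedTreeDecomposition G)

theorem isFlatBag_holds_iff (a b : N.Elem) : IsFlatBag N.Holds a b ↔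
    ∃ v x y, a = .main (.vertex v) ∧ b = .marginal x (.node y) ∧ v ∈ N.flatBag ⟨x, y⟩ := by
  constructor
  · rintro ⟨c, hc, hab⟩
    obtain ⟨x, y, rfl, rfl⟩ := (N.holds_marginal_iff _ _).1 hc
    rcases hab with hab | hab
    · obtain ⟨v, rfl⟩ := ((N.realizes_marginal x).vertex a).1 hab.1.1
      exact ⟨v, x, y, rfl, rfl, mem_flatBag_iff.2
        (Or.inl ⟨v.2, ((N.realizes_marginal x).bag v y).1 hab⟩)⟩
    · obtain ⟨v, rfl⟩ := (N.realizes_main.vertex a).1 hab.1.1.1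
      exact ⟨v, x, y, rfl, rfl, mem_flatBag_iff.2
        (Or.inr ((N.realizes_main.adhesion x v).1 hab))⟩
  · rintro ⟨v, x, y, rfl, rfl, hv⟩
    refine ⟨.main (.node x), .marginal x y, (mem_flatBag_iff.1 hv).imp ?_ ?_⟩
    · rintro ⟨hx, hy⟩
      exact ((N.realizes_marginal x).bag ⟨v, hx⟩ y).2 hy
    · exact (N.realizes_main.adhesion x v).2

theorem isFlatParent_holds_iff (a b : N.Elem) : IsFlatParent N.Holds a b ↔
    ∃ x' y' x y, a = .marginal x' (.node y') ∧ b = .marginal x (.node y) ∧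
      N.FlatParent ⟨x', y'⟩ ⟨x, y⟩ := by
  have isRoot_iff : ∀ x y, (¬ ∃ c, (relMarginal N.Holds (.main (.node x))).parent c
      (.marginal x (.node y))) ↔ (N.marginal x).parent y = none := by
    intro x y
    rw [Option.eq_none_iff_forall_ne_some, not_exists]
    constructor
    · intro h y' hy'
      exact h _ (((N.realizes_marginal x).parent y' y).2 hy')
    · intro h c hc
      obtain ⟨y', rfl⟩ := ((N.realizes_marginal x).node c).1 hc.1.1
      exact h y' (((N.realizes_marginal x).parent y' y).1 hc)
  constructor
  · rintro ⟨c, hc, hab⟩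
    obtain ⟨x, y, rfl, rfl⟩ := (N.holds_marginal_iff _ _).1 hc
    rcases hab with hab | ⟨hroot, hsub, w, hw, d, hd⟩
    · obtain ⟨y', rfl⟩ := ((N.realizes_marginal x).node a).1 hab.1.1
      exact ⟨x, y', x, y, rfl, rfl, .inner x y y' (((N.realizes_marginal x).parent y' y).1 hab)⟩
    · obtain ⟨x', y', rfl, rfl⟩ := (N.holds_marginal_iff _ _).1 hd.1.1.2
      obtain ⟨v, rfl⟩ := ((N.realizes_marginal x').vertex w).1 hd.1.1.1
      have htop : N.flatTop v = ⟨x', y'⟩ :=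
        flatTop_eq_iff.2 ⟨v.2, ((N.realizes_marginal x').margin y' v).1 hd⟩
      refine ⟨x', y', x, y, rfl, rfl, ?_⟩
      rw [← htop]
      refine .outer x y v ((isRoot_iff x y).1 hroot) ((N.realizes_main.adhesion x v).1 hw) ?_
      intro u hu
      obtain ⟨_, _, _, ⟨⟩, ⟨⟩, hu'⟩ := (N.isFlatBag_holds_iff _ _).1
        (hsub _ ((N.realizes_main.adhesion x u).2 hu))
      rw [htop]
      exact hu'
  · rintro ⟨x', y', x, y, rfl, rfl, h⟩
    refine ⟨.main (.node x), .marginal x y, ?_⟩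
    generalize hb : (⟨x', y'⟩ : N.FlatNode) = b at h
    cases h with
    | inner _ _ z h =>
      cases hb
      exact Or.inl (((N.realizes_marginal _).parent _ _).2 h)
    | outer _ _ w h hw hsub =>
      obtain ⟨hx', hy'⟩ := flatTop_eq_iff.1 hb.symm
      refine Or.inr ⟨(isRoot_iff x y).2 h, fun c hc => ?_, _,
        (N.realizes_main.adhesion x w).2 hw, _,
        ((N.realizes_marginal x').margin y' ⟨w, hx'⟩).2 hy'⟩
      obtain ⟨u, rfl⟩ := (N.realizes_main.vertex c).1 hc.1.1.1
      exact (N.isFlatBag_holds_iff _ _).2 ⟨u, x', y', rfl, rfl,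
        hb ▸ hsub ((N.realizes_main.adhesion x u).1 hc)⟩

/-- The elements of the encoding of the flattened decomposition, as elements of the encoding of the
nested one. -/
def ofFlatten [Finite V] : N.flatten.Elem → N.Elem
  | .vertex v => .main (.vertex v)
  | .edge e => .main (.edge e)
  | .node ⟨x, y⟩ => .marginal x (.node y)

theorem ofFlatten_injective [Finite V] : Function.Injective N.ofFlatten := by
  rintro (v | e | ⟨x, y⟩) (v' | e' | ⟨x', y'⟩) h <;> cases h <;> rfl

theorem isFlatElem_holds_iff [Finite V] (a : N.Elem) :
    IsFlatElem N.Holds a ↔ ∃ b, N.ofFlatten b = a := by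
  constructor
  · rintro (h | ⟨v, hv, h⟩ | ⟨x, h⟩)
    · obtain ⟨v, rfl⟩ := (N.isMainVertex_holds_iff a).1 h
      exact ⟨.vertex v, rfl⟩
    · obtain ⟨v, rfl⟩ := (N.isMainVertex_holds_iff v).1 hv
      rcases (N.holds_incident_iff _ _).1 h with ⟨_, e, -, rfl, -⟩ | ⟨_, _, _, ⟨⟩, -, -⟩
      exact ⟨.edge e, rfl⟩
    · obtain ⟨x, y, rfl, -⟩ := (N.holds_marginal_iff _ _).1 h
      exact ⟨.node ⟨x, y⟩, rfl⟩
  · rintro ⟨v | e | ⟨x, y⟩, rfl⟩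
    · exact Or.inl ((N.isMainVertex_holds_iff _).2 ⟨v, rfl⟩)
    · exact Or.inr (Or.inl ⟨_, (N.isMainVertex_holds_iff _).2 ⟨_, rfl⟩,
        (N.holds_incident_iff _ _).2 (Or.inl ⟨_, e, rfl, rfl, Sym2.out_fst_mem _⟩)⟩)
    · exact Or.inr (Or.inr ⟨_, .marginal x y⟩)

theorem flatHolds_ofFlatten_iff [Finite V] (r : TreeDecomposition.RelName)
    (a b : N.flatten.Elem) :
    FlatHolds N.Holds r (N.ofFlatten a) (N.ofFlatten b) ↔ N.flatten.Holds r a b := by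
  constructor
  · intro h
    cases r with
    | incident =>
      rcases (N.holds_incident_iff _ _).1 h with ⟨v, e, ha, hb, hv⟩ | ⟨x, v, e, -, hb, -⟩
      · obtain rfl : a = .vertex v := N.ofFlatten_injective ha
        obtain rfl : b = .edge e := N.ofFlatten_injective hb
        exact .incident v e hv
      · rcases b with v | e | ⟨x, y⟩ <;> cases hb
    | bag =>
      obtain ⟨v, x, y, ha, hb, hv⟩ := (N.isFlatBag_holds_iff _ _).1 h
      obtain rfl : a = .vertex v := N.ofFlatten_injective ha
      obtain rfl : b = .node (⟨x, y⟩ : N.FlatNode) := N.ofFlatten_injective hb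
      exact .bag v _ hv
    | parent =>
      obtain ⟨x', y', x, y, ha, hb, hp⟩ := (N.isFlatParent_holds_iff _ _).1 h
      obtain rfl : a = .node (⟨x', y'⟩ : N.FlatNode) := N.ofFlatten_injective ha
      obtain rfl : b = .node (⟨x, y⟩ : N.FlatNode) := N.ofFlatten_injective hb
      exact .parent _ _ (flatten_parent.2 hp)
  · intro h
    cases h with
    | incident v e h => exact (N.holds_incident_iff _ _).2 (Or.inl ⟨v, e, rfl, rfl, h⟩)
    | bag v x h => exact (N.isFlatBag_holds_iff _ _).2 ⟨v, x.1, x.2, rfl, rfl, h⟩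
    | parent x y h =>
      exact (N.isFlatParent_holds_iff _ _).2
        ⟨x.1, x.2, y.1, y.2, rfl, rfl, flatten_parent.1 h⟩

theorem flattenInterpretation_apply_encode [Finite V] :
    (flattenInterpretation.apply N.encode).Isomorphic N.flatten.encode := by
  refine Struct.Isomorphic.symm ⟨Equiv.ofBijective
    (fun b => ⟨N.ofFlatten b, (univ_sat_iff N.encode _).2 ((N.isFlatElem_holds_iff _).2 ⟨b, rfl⟩)⟩)
    ⟨fun b c h => N.ofFlatten_injective (congrArg Subtype.val h), ?_⟩, fun r a => ?_⟩
  · rintro ⟨a, ha⟩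
    obtain ⟨b, rfl⟩ := (N.isFlatElem_holds_iff a).1 ((univ_sat_iff N.encode a).1 ha)
    exact ⟨b, rfl⟩
  · exact ((rel_sat_iff N.encode r (fun i => N.ofFlatten (a i))).trans
      (N.flatHolds_ofFlatten_iff r _ _)).symm

end NestedTreeDecomposition

/-- The domain of the interpretation consists of the encodings of nested tree decompositions. -/
theorem exists_isomorphic_encode_iff
    (A : MSO.Struct (MSO.Vocabulary.binary NestedTreeDecomposition.RelName)) :
    NestedTreeDecomposition.flattenInterpretation.dom.Sat A ![] ![] ↔
      ∃ (V : Type) (_ : Finite V) (G : SimpleGraph V) (N : NestedTreeDecomposition G),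
        A.Isomorphic N.encode := by
  constructor
  · intro h
    have := A.finite
    obtain ⟨V, hV, G, N, e, he⟩ :=
      ((NestedTreeDecomposition.dom_sat_iff A).1 h).exists_equiv
    refine ⟨V, hV, G, N, MSO.Struct.Isomorphic.symm ⟨e, fun r a => ?_⟩⟩
    exact (he r _ _).trans (A.rel_iff_holds r fun i => e (a i)).symm
  · rintro ⟨V, hV, G, N, h⟩
    rw [MSO.Formula.sat_iff_of_isomorphic h]
    exact (NestedTreeDecomposition.dom_sat_iff N.encode).2 N.isEncoding_holds

theorem mainTheorem10 :
    ∃ F : MSO.Transduction (MSO.Vocabulary.binary NestedTreeDecomposition.RelName)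
        (MSO.Vocabulary.binary TreeDecomposition.RelName),
      F.Deterministic ∧
      (∀ A : MSO.Struct (MSO.Vocabulary.binary NestedTreeDecomposition.RelName),
        (F.outputs A).Nonempty ↔
          ∃ (V : Type) (_ : Finite V) (G : SimpleGraph V) (N : NestedTreeDecomposition G),
            A.Isomorphic N.encode) ∧
      (∀ (V : Type) [Finite V] (G : SimpleGraph V) (N : NestedTreeDecomposition G)
        (A : MSO.Struct (MSO.Vocabulary.binary NestedTreeDecomposition.RelName)),
        A.Isomorphic N.encode →
          ∃ B : MSO.Struct (MSO.Vocabulary.binary TreeDecomposition.RelName),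
            F.outputs A = {B} ∧
            ∃ s : TreeDecomposition G, B.Isomorphic s.encode ∧
              ∀ k : ℕ, N.width ≤ k → s.width ≤ k) := by
  refine ⟨.interpretation NestedTreeDecomposition.flattenInterpretation, trivial, fun A => ?_,
    fun V hV G N A hA => ?_⟩
  · rw [← exists_isomorphic_encode_iff]
    exact ⟨fun ⟨_, h, _⟩ => h, fun h => ⟨_, h, rfl⟩⟩
  · refine ⟨NestedTreeDecomposition.flattenInterpretation.apply A, ?_, N.flatten,
      (MSO.Interpretation.apply_isomorphic _ hA).trans N.flattenInterpretation_apply_encode,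
      fun k hk => NestedTreeDecomposition.width_flatten_le.trans hk⟩
    have hdom := (exists_isomorphic_encode_iff A).2 ⟨V, hV, G, N, hA⟩
    exact Set.ext fun B => ⟨fun h => h.2, fun h => ⟨hdom, h⟩⟩
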